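/- **Setting.** Let $(\Omega,d)$ be a compact metric space with a non-atomic Borel probability measure $m$, and let $\mathcal R=\{R_\alpha\}_{\alpha\in J}$ be a family of subsets of $\Omega$ (the resonant sets), indexed by an infinite countable set $J$. Let $\beta:J\to\mathbb R^+$, $\alpha\mapsto\beta_\alpha$, be such that $\{\alpha\in J:\beta_\alpha\le K\}$ is finite for every $K$. Write $B(x,r)$ for the ball with centre $x$ and radius $r$, and $\Delta(A,\varepsilon)=\{x\in\Omega:\operatorname{dist}(x,A)<\varepsilon\}$ for the $\varepsilon$-neighbourhood of $A$. An *approximating function* is a decreasing function $\psi:\mathbb R^+\to\mathbb R^+$; put $$\Lambda(\psi)=\{x\in\Omega: x\in\Delta(R_\alpha,\psi(\beta_\alpha))\text{ for infinitely many }\alpha\in J\}.$$ Let $l=(l_n)$ and $u=(u_n)$ be positive increasing (not necessarily strictly) sequences with $l_n<u_n$ and $l_n\to\infty$, and let $\rho:\mathbb R^+\to\mathbb R^+$ be a function with $\rho(r)\to0$ as $r\to\infty$. Put $\Delta_l^u(\rho,n)=\bigcup_{\alpha:\ l_n<\beta_\alpha\le u_n}\Delta(R_\alpha,\rho(u_n))$.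 *Condition (M2)* with exponent $\delta>0$: there are constants $a,b,r_o>0$ with $a\,r^\delta\le m(B(x,r))\le b\,r^\delta$ for all $x\in\Omega$ and $0<r\le r_o$. $(\mathcal R,\beta)$ is a *locally $m$-ubiquitous system relative to $(\rho,l,u)$*, with common dimension $\gamma$, if * there are constants $\kappa,r_0>0$ such that for every ball $B$ with centre in $\Omega$ and radius at most $r_0$ there is $n_o(B)$ with $m(B\cap\Delta_l^u(\rho,n))\ge\kappa\, m(B)$ for all $n\ge n_o(B)$; and * (*intersection conditions*) $0\le\gamma\le\dim\Omega$ (Hausdorff dimension), and there are constants $c_1,c_2>0$ such that for all sufficiently large $n$, all $\alpha\in J$ with $\beta_\alpha\le u_n$, all $c\in R_\alpha$ and all $0<\lambda\le\rho(u_n)$, $$m\big(B(c,\tfrac12\rho(u_n))\cap\Delta(R_\alpha,\lambda)\big)\ \ge\ c_1\, m(B(c,\lambda))\Big(\frac{\rho(u_n)}{\lambda}\Big)^{\gamma},$$ $$m\big(B\cap B(c,3\rho(u_n))\cap\Delta(R_\alpha,3\lambda)\big)\ \le\ c_2\, m(B(c,\lambda))\Big(\frac{r(B)}{\lambda}\Big)^{\gamma}$$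 for every ball $B$ centred at a point of a resonant set with radius $r(B)\le3\rho(u_n)$. A function $h$ is *$u$-regular* if there is a constant $0<\lambda<1$ with $h(u_{n+1})\le\lambda\,h(u_n)$ for all sufficiently large $n$. **Corollary 4.** Suppose that $m$ satisfies (M2) with exponent $\delta$, that $(\mathcal R,\beta)$ is a locally $m$-ubiquitous system relative to $(\rho,l,u)$ with common dimension $\gamma$, and that $\psi$ is an approximating function. Let $s\ge0$ with $\gamma<s<\delta$, let $g(r)=\psi(r)^{s-\gamma}\rho(r)^{\gamma-\delta}$ and let $G=\limsup_{n\to\infty}g(u_n)\in[0,\infty]$. Let $\mathcal H^s$ denote $s$-dimensional Hausdorff measure. 1. If $G=0$ and either $\psi$ or $\rho$ is $u$-regular, then $\mathcal H^s(\Lambda(\psi))=\infty$ whenever $\sum_{n=1}^\infty g(u_n)=\infty$. 2. If $0<G\le\infty$, then $\mathcal H^s(\Lambda(\psi))=\infty$. -/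

import Mathlib

open MeasureTheory Filter Topology
open scoped ENNReal

namespace Ubiquity

/-- Condition (M2): the measure of every ball of small radius, centred at a point of the space, is
comparable to the `δ`-th power of its radius. -/
def MeasureM2 {Ω : Type*} [MetricSpace Ω] [MeasurableSpace Ω] (m : Measure Ω) (δ : ℝ) : Prop :=
  0 < δ ∧ ∃ a b r₀ : ℝ, 0 < a ∧ 0 < b ∧ 0 < r₀ ∧
    ∀ (x : Ω) (r : ℝ), 0 < r → r ≤ r₀ →
      ENNReal.ofReal (a * r ^ δ) ≤ m (Metric.ball x r) ∧
        m (Metric.ball x r) ≤ ENNReal.ofReal (b * r ^ δ)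

/-- A weight on the index set of the resonant sets: a positive function such that only finitely
many indices have weight below any given bound. -/
def IsWeight {J : Type*} (β : J → ℝ) : Prop :=
  (∀ α, 0 < β α) ∧ ∀ K : ℝ, {α | β α ≤ K}.Finite

/-- `l` and `u` are a lower and an upper sequence: positive, increasing, `l n < u n`, `l n → ∞`. -/
structure IsLowerUpper (l u : ℕ → ℝ) : Prop where
  lower_pos : ∀ n, 0 < l n
  lower_mono : Monotone l
  upper_mono : Monotone u
  lt : ∀ n, l n < u n
  tendsto : Tendsto l atTop atTop

/-- Approximating functions `ℝ⁺ → ℝ⁺`: positive and decreasing on the positive half line. -/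
def IsApproximating (ψ : ℝ → ℝ) : Prop :=
  (∀ r, 0 < r → 0 < ψ r) ∧ AntitoneOn ψ (Set.Ioi 0)

/-- Ubiquitous functions `ℝ⁺ → ℝ⁺`: positive on the positive half line, tending to `0` at `∞`. -/
def IsUbiquityFunction (ρ : ℝ → ℝ) : Prop :=
  (∀ r, 0 < r → 0 < ρ r) ∧ Tendsto ρ atTop (𝓝 0)

/-- The limsup set `Λ(ψ)`: the points lying in `Δ(R α, ψ (β α))` for infinitely many `α`, where
`Δ(A, ε)` is the open `ε`-neighbourhood of `A`. -/
def limsupSet {Ω J : Type*} [MetricSpace Ω] (R : J → Set Ω) (β : J → ℝ) (ψ : ℝ → ℝ) : Set Ω :=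
  {x | {α | x ∈ Metric.thickening (ψ (β α)) (R α)}.Infinite}

/-- `Δ_l^u(ρ, n)`: the union of the `ρ (u n)`-neighbourhoods of the resonant sets `R α` with
`l n < β α ≤ u n`. -/
def ubiquityUnion {Ω J : Type*} [MetricSpace Ω] (R : J → Set Ω) (β : J → ℝ) (ρ : ℝ → ℝ)
    (l u : ℕ → ℝ) (n : ℕ) : Set Ω :=
  ⋃ α ∈ {α | l n < β α ∧ β α ≤ u n}, Metric.thickening (ρ (u n)) (R α)

/-- The intersection conditions with common dimension `γ`. The constants `c₁`, `c₂` and the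
threshold on `n` do not depend on `α`, `c`, `t` or the ball `B = Metric.ball y r`, which is centred
on an arbitrary resonant set `R α'`. -/
def IntersectionConditions {Ω J : Type*} [MetricSpace Ω] [MeasurableSpace Ω] (m : Measure Ω)
    (R : J → Set Ω) (β : J → ℝ) (ρ : ℝ → ℝ) (u : ℕ → ℝ) (γ : ℝ) : Prop :=
  0 ≤ γ ∧ ENNReal.ofReal γ ≤ dimH (Set.univ : Set Ω) ∧
  ∃ c₁ c₂ : ℝ, 0 < c₁ ∧ 0 < c₂ ∧ ∀ᶠ n in atTop,
    ∀ α, β α ≤ u n → ∀ c ∈ R α, ∀ t : ℝ, 0 < t → t ≤ ρ (u n) →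
      ENNReal.ofReal (c₁ * (ρ (u n) / t) ^ γ) * m (Metric.ball c t) ≤
          m (Metric.ball c (1 / 2 * ρ (u n)) ∩ Metric.thickening t (R α)) ∧
        ∀ α', ∀ y ∈ R α', ∀ r : ℝ, 0 < r → r ≤ 3 * ρ (u n) →
          m (Metric.ball y r ∩ Metric.ball c (3 * ρ (u n)) ∩ Metric.thickening (3 * t) (R α)) ≤
            ENNReal.ofReal (c₂ * (r / t) ^ γ) * m (Metric.ball c t)

/-- `(R, β)` is a local `m`-ubiquitous system relative to `(ρ, l, u)`, with common dimension `γ`.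
The constant `κ` is uniform, while the threshold on `n` may depend on the ball. -/
def IsLocallyUbiquitous {Ω J : Type*} [MetricSpace Ω] [MeasurableSpace Ω] (m : Measure Ω)
    (R : J → Set Ω) (β : J → ℝ) (ρ : ℝ → ℝ) (l u : ℕ → ℝ) (γ : ℝ) : Prop :=
  (∃ κ r₀ : ℝ, 0 < κ ∧ 0 < r₀ ∧ ∀ (x : Ω) (r : ℝ), 0 < r → r ≤ r₀ → ∀ᶠ n in atTop,
    ENNReal.ofReal κ * m (Metric.ball x r) ≤ m (Metric.ball x r ∩ ubiquityUnion R β ρ l u n)) ∧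
  IntersectionConditions m R β ρ u γ

/-- `h` is `u`-regular. -/
def IsRegular (h : ℝ → ℝ) (u : ℕ → ℝ) : Prop :=
  ∃ lam : ℝ, 0 < lam ∧ lam < 1 ∧ ∀ᶠ n in atTop, h (u (n + 1)) ≤ lam * h (u n)

/-- The function `g(r) = ψ(r)^(s - γ) ρ(r)^(γ - δ)`. -/
noncomputable def gFun (ψ ρ : ℝ → ℝ) (s γ δ : ℝ) (r : ℝ) : ℝ :=
  ψ r ^ (s - γ) * ρ r ^ (γ - δ)

/-- `G = limsup g(u n)`, an element of `[0, ∞]`. -/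
noncomputable def limsupG (ψ ρ : ℝ → ℝ) (u : ℕ → ℝ) (s γ δ : ℝ) : ℝ≥0∞ :=
  limsup (fun n => ENNReal.ofReal (gFun ψ ρ s γ δ (u n))) atTop

end Ubiquity

/-! Infinite Hausdorff measure follows from the mass distribution principle: for every `ε > 0` it
suffices to find a probability measure on the limsup set giving small balls of radius `t` mass at
most a constant times `ε * t ^ s`. No Cantor set is built; the measure is a weak limit of measures
dominated by multiples of `m`, each obtained from the previous one by moving mass a tiny distance
(`hausdorffMeasure_eq_top_of_refining`, `exists_limit_measure`).

The moves use level measures (`exists_level_measure`). One of them lives near resonant sets within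
distance `q`, resembles `m` above scale `ρ`, and below `ρ` has ball mass `≲ g⁻¹ * t ^ s * min (t /
q) (q / t) ^ e`, where `g = q ^ (s - γ) * ρ ^ (γ - δ)`. Averaging levels with weights proportional
to `g` cancels `g⁻¹`. If the `q i` decay geometrically, the sum of the `min` factors is bounded for
each `t`, so the average has ball mass `≲ t ^ s / ∑ g`, up to a term in `t ^ δ`. Divergence of `∑ g`
makes the constant as small as desired (`exists_superposed_measure`).

It remains to choose levels and radii `q ≤ ρ`, `q < ψ`, with geometric decay of `q` and divergent `∑
g`. Regularity of `ψ` gives this directly; regularity of `ρ` gives it along a subsequence; for `G >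
0` the radii are shrunk until `g` is constant. -/

namespace Ubiquity

/-! ### Weak limits of successively displaced measures. -/

/-- Iterating approximations of probability measures on a compact space yields a limit measure,
carried by the sets on which the approximations live and inheriting their bounds on small balls. -/
theorem exists_limit_measure {Ω : Type*} [MetricSpace Ω] [CompactSpace Ω] [MeasurableSpace Ω]
    [BorelSpace Ω] (μ : ℕ → Measure Ω) [∀ k, IsProbabilityMeasure (μ k)] (e : ℕ → ℝ)
    (he : ∀ k, 0 < e k) (he2 : ∀ k, e (k + 1) ≤ e k / 2) (F : ℝ → ℝ≥0∞)
    (htrans : ∀ k E, μ (k + 1) E ≤ μ k (Metric.thickening (e k / 2) E))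
    (hball : ∀ k x t, 0 < t → t ≤ e k → μ (k + 1) (Metric.ball x (2 * t)) ≤ F t)
    (A : ℕ → Set Ω) (O : ℕ → Set Ω) (hA : ∀ k, μ (k + 1) (A k)ᶜ = 0)
    (hAO : ∀ k, Metric.cthickening (e (k + 1)) (A k) ⊆ O k) :
    ∃ ν : Measure Ω, IsProbabilityMeasure ν ∧ (∀ k, ν (O k)ᶜ = 0) ∧
      ∀ x t, 0 < t → t ≤ e 0 → ν (Metric.ball x t) ≤ F t := by
  -- The first step moves mass by `e k / 2`, and all later ones together by at most `e (k + 1) ≤ e k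
  -- / 2`; the total is at most `e k`, uniformly in `d`.
  have hiter : ∀ d k E, μ (k + d) E ≤ μ k (Metric.thickening (e k) E) := by
    intro d
    induction d with
    | zero =>
      intro k E
      exact measure_mono (Metric.self_subset_thickening (he k) E)
    | succ d ih =>
      intro k E
      have h1 := ih (k + 1) E
      rw [show k + 1 + d = k + (d + 1) by ring] at h1
      refine h1.trans ((htrans k _).trans (measure_mono ?_))
      refine (Metric.thickening_thickening_subset _ _ _).trans (Metric.thickening_mono ?_ _)
      linarith [he2 k]
  have hiter' : ∀ k j E, k ≤ j → μ j E ≤ μ k (Metric.thickening (e k) E) := by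
    intro k j E hkj
    obtain ⟨d, rfl⟩ := Nat.exists_eq_add_of_le hkj
    exact hiter d k E
  let P : ℕ → ProbabilityMeasure Ω := fun k => ⟨μ k, inferInstance⟩
  obtain ⟨ν, -, φ, hφ, hlim⟩ := isCompact_univ.tendsto_subseq (x := P) (fun n => Set.mem_univ _)
  -- Portmanteau: weak limits do not gain mass on open sets. Both conclusions are therefore tested
  -- on open sets.
  have hopen : ∀ G : Set Ω, IsOpen G → ∀ c : ℝ≥0∞, (∀ᶠ j in atTop, μ j G ≤ c) →
      (ν : Measure Ω) G ≤ c := by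
    intro G hG c hc
    refine (ProbabilityMeasure.le_liminf_measure_open_of_tendsto hlim hG).trans ?_
    refine liminf_le_of_frequently_le' ?_
    exact ((hφ.tendsto_atTop.eventually hc).frequently)
  refine ⟨ν, inferInstance, fun k => ?_, fun x t ht hte => ?_⟩
  · refine measure_mono_null (Set.compl_subset_compl.2 (hAO k)) (le_antisymm ?_ zero_le)
    refine hopen _ Metric.isClosed_cthickening.isOpen_compl _ ?_
    filter_upwards [eventually_ge_atTop (k + 1)] with j hj
    refine (hiter' _ _ _ hj).trans ((measure_mono ?_).trans (hA k).le)
    intro y hy hyA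
    obtain ⟨z, hz, hyz⟩ := Metric.mem_thickening_iff.1 hy
    apply hz
    refine Metric.thickening_subset_cthickening _ _ (Metric.mem_thickening_iff.2 ⟨y, hyA, ?_⟩)
    rwa [dist_comm]
  · have hek : ∀ k, e k ≤ e 0 / 2 ^ k := by
      intro k
      induction k with
      | zero => simp
      | succ k ih =>
        refine (he2 k).trans ?_
        rw [pow_succ, ← div_div]
        linarith
    -- The first such index is some `k + 1`, so `e (k + 1) < t ≤ e k`: later displacements stay
    -- inside the ball of radius `2 * t`, where the bound for `μ (k + 1)` applies.
    have hex : ∃ k, e k < t := by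
      obtain ⟨k, hk⟩ := exists_pow_lt_of_lt_one (div_pos ht (he 0)) (by norm_num : (1 / 2 : ℝ) < 1)
      refine ⟨k, (hek k).trans_lt ?_⟩
      rw [lt_div_iff₀ (he 0)] at hk
      calc e 0 / 2 ^ k = (1 / 2) ^ k * e 0 := by rw [one_div, inv_pow]; field_simp
        _ < t := hk
    classical
    have hk := Nat.find_spec hex
    have hmin := fun {m} => Nat.find_min hex (m := m)
    obtain ⟨k, hkk⟩ : ∃ k, Nat.find hex = k + 1 := by
      refine Nat.exists_eq_succ_of_ne_zero fun h0 => ?_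
      rw [h0] at hk
      linarith
    rw [hkk] at hk
    have hk' : t ≤ e k := not_lt.1 (hmin (by omega))
    refine hopen _ Metric.isOpen_ball _ ?_
    filter_upwards [eventually_ge_atTop (k + 1)] with j hj
    refine (hiter' _ _ _ hj).trans ((measure_mono ?_).trans (hball k x t ht hk'))
    intro y hy
    obtain ⟨z, hz, hyz⟩ := Metric.mem_thickening_iff.1 hy
    have := dist_triangle y z x
    rw [Metric.mem_ball] at hz ⊢
    linarith

/-! ### Separated nets. -/

/-- A maximal separated finite subset of an arbitrary set in a compact space. -/
theorem exists_finset_separated_cover {Ω : Type*} [MetricSpace Ω] [CompactSpace Ω] (P : Set Ω)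
    {r : ℝ} (hr : 0 < r) :
    ∃ T : Finset Ω, (↑T : Set Ω) ⊆ P ∧ (∀ c ∈ T, ∀ c' ∈ T, c ≠ c' → r ≤ dist c c') ∧
      ∀ y ∈ P, ∃ c ∈ T, dist y c < r := by
  have hT : ∃ M, Maximal (fun N : Set Ω => N ⊆ P ∧ N.Pairwise fun c c' => r ≤ dist c c') M := by
    refine zorn_subset _ fun c hc hchain => ⟨⋃₀ c, ⟨Set.sUnion_subset fun s hs => (hc hs).1, ?_⟩,
      fun s hs => Set.subset_sUnion_of_mem hs⟩
    rw [Set.pairwise_sUnion hchain.directedOn]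
    exact fun s hs => (hc hs).2
  obtain ⟨M, hM⟩ := hT
  -- Two points in one ball of radius `r / 2` are less than `r` apart, so each ball of a finite
  -- cover contains at most one point of `M`.
  have hfin : M.Finite := by
    obtain ⟨t, ht, hcov⟩ := Metric.totallyBounded_iff.1 (isCompact_univ (X := Ω)).totallyBounded
      (r / 2) (half_pos hr)
    choose! f hf using fun y : Ω => by simpa using hcov (Set.mem_univ y)
    refine Set.Finite.of_injOn (f := f) (t := t) (fun y _ => (hf y).1) ?_ ht
    intro y hy z hz hyz
    by_contra hne
    have h1 := hM.prop.2 hy hz hne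
    have h2 := (hf y).2
    have h3 := (hf z).2
    rw [← hyz] at h3
    have := dist_triangle_right y z (f y)
    linarith
  refine ⟨hfin.toFinset, by simpa using hM.prop.1, ?_, ?_⟩
  · intro c hc c' hc' hne
    exact hM.prop.2 (by simpa using hc) (by simpa using hc') hne
  · intro y hy
    by_contra! hcon
    have hsub : insert y M ⊆ M := by
      refine hM.le_of_ge ⟨Set.insert_subset hy hM.prop.1, ?_⟩ (Set.subset_insert _ _)
      rw [Set.pairwise_insert]
      refine ⟨hM.prop.2, fun z hz _ => ?_⟩
      have := hcon z (by simpa using hz)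
      exact ⟨this, by rwa [dist_comm]⟩
    have hyM : y ∈ M := hsub (Set.mem_insert _ _)
    have := hcon y (by simpa using hyM)
    rw [dist_self] at this
    linarith

/-! ### Geometric decay and power identities. -/

theorem pow_mul_le_of_le_mul {q : ℕ → ℝ} {θ : ℝ} (hθ : 0 ≤ θ) (hstep : ∀ i, q (i + 1) ≤ θ * q i)
    {i j : ℕ} (hij : i ≤ j) : q j ≤ θ ^ (j - i) * q i := by
  obtain ⟨d, rfl⟩ := Nat.exists_eq_add_of_le hij
  rw [Nat.add_sub_cancel_left]
  induction d with
  | zero => simp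
  | succ d ih =>
    have := ih (by omega)
    calc q (i + (d + 1)) ≤ θ * q (i + d) := hstep _
      _ ≤ θ * (θ ^ d * q i) := by gcongr
      _ = θ ^ (d + 1) * q i := by ring

theorem sum_pow_le_of_injOn {η : ℝ} (h0 : 0 ≤ η) (h1 : η < 1) (F : Finset ℕ) (f : ℕ → ℕ)
    (hf : Set.InjOn f F) : ∑ i ∈ F, η ^ f i ≤ (1 - η)⁻¹ := by
  rw [← Finset.sum_image (f := fun k => η ^ k) (fun a ha b hb h => hf ha hb h),
    ← tsum_geometric_of_lt_one h0 h1]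
  exact (summable_geometric_of_lt_one h0 h1).sum_le_tsum _ fun _ _ => by positivity

/-- A sequence decaying geometrically spends a bounded amount of time near each scale. -/
theorem sum_min_ratio_rpow_le {q : ℕ → ℝ} (hq : ∀ i, 0 < q i) {θ : ℝ} (hθ0 : 0 < θ) (hθ1 : θ < 1)
    (hstep : ∀ i, q (i + 1) ≤ θ * q i) {e : ℝ} (he : 0 < e) {t : ℝ} (ht : 0 < t) (F : Finset ℕ) :
    ∑ i ∈ F, (min (t / q i) (q i / t)) ^ e ≤ 2 * (1 - θ ^ e)⁻¹ := by
  have hη0 : 0 ≤ θ ^ e := by positivity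
  have hη1 : θ ^ e < 1 := Real.rpow_lt_one hθ0.le hθ1 he
  have hpos : 0 ≤ (1 - θ ^ e)⁻¹ := inv_nonneg.2 (by linarith)
  have hmin : ∀ i, 0 ≤ min (t / q i) (q i / t) := fun i =>
    le_min (div_pos ht (hq i)).le (div_pos (hq i) ht).le
  have hbound : ∀ G : Finset ℕ, ∀ f : ℕ → ℕ, Set.InjOn f G →
      (∀ i ∈ G, min (t / q i) (q i / t) ≤ θ ^ f i) →
      ∑ i ∈ G, (min (t / q i) (q i / t)) ^ e ≤ (1 - θ ^ e)⁻¹ := by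
    intro G f hf hG
    refine (Finset.sum_le_sum fun i hi => ?_).trans (sum_pow_le_of_injOn hη0 hη1 G f hf)
    refine (Real.rpow_le_rpow (hmin i) (hG i hi) he.le).trans (le_of_eq ?_)
    rw [← Real.rpow_natCast, ← Real.rpow_natCast, ← Real.rpow_mul hθ0.le, ← Real.rpow_mul hθ0.le,
      mul_comm]
  -- Where `q i ≥ t`, count backwards from the last such index and use `t / q i`; elsewhere count
  -- forwards from the first index and use `q i / t`. Each part is dominated by one geometric
  -- series.
  rw [← Finset.sum_filter_add_sum_filter_not F (fun i => t ≤ q i), two_mul]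
  refine add_le_add ?_ ?_
  · set G := F.filter fun i => t ≤ q i with hGdef
    rcases G.eq_empty_or_nonempty with hG | hG
    · rw [hG]; simpa using hpos
    · have hk := G.max'_mem hG
      set k := G.max' hG
      have hle : ∀ i ∈ G, i ≤ k := fun i hi => G.le_max' i hi
      refine hbound G (fun i => k - i) ?_ ?_
      · intro i hi j hj hij
        have := hle i hi
        have := hle j hj
        simp only at hij
        omega
      · intro i hi
        refine (min_le_left _ _).trans ?_
        rw [div_le_iff₀ (hq i)]
        exact (Finset.mem_filter.1 hk).2.trans (pow_mul_le_of_le_mul hθ0.le hstep (hle i hi))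
  · set G := F.filter fun i => ¬ t ≤ q i with hGdef
    rcases G.eq_empty_or_nonempty with hG | hG
    · rw [hG]; simpa using hpos
    · have hk := G.min'_mem hG
      set k := G.min' hG
      have hle : ∀ i ∈ G, k ≤ i := fun i hi => G.min'_le i hi
      refine hbound G (fun i => i - k) ?_ ?_
      · intro i hi j hj hij
        have := hle i hi
        have := hle j hj
        simp only at hij
        omega
      · intro i hi
        refine (min_le_right _ _).trans ?_
        rw [div_le_iff₀ ht]
        refine (pow_mul_le_of_le_mul hθ0.le hstep (hle i hi)).trans ?_
        have := (Finset.mem_filter.1 hk).2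
        gcongr
        linarith

/-- The exponents are arranged so that `g⁻¹ * t ^ s` splits off the mass bound for scales `t ≤ q`;
the remaining factor is a gain when `s < δ`. The companion identity does the same for `q ≤ t`, with
a gain when `γ < s`. -/
theorem rpow_scale_identity_left {ρ q t : ℝ} (hρ : 0 < ρ) (hq : 0 < q) (ht : 0 < t) (δ γ s : ℝ) :
    (ρ / q) ^ (δ - γ) * t ^ δ = (q ^ (s - γ) * ρ ^ (γ - δ))⁻¹ * t ^ s * (t / q) ^ (δ - s) := by
  rw [Real.div_rpow hρ.le hq.le, Real.div_rpow ht.le hq.le]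
  simp only [Real.rpow_sub hρ, Real.rpow_sub hq, Real.rpow_sub ht]
  have h1 := fun x : ℝ => (Real.rpow_pos_of_pos hρ x).ne'
  have h2 := fun x : ℝ => (Real.rpow_pos_of_pos hq x).ne'
  have h3 := fun x : ℝ => (Real.rpow_pos_of_pos ht x).ne'
  have := h1 δ; have := h1 γ; have := h2 δ; have := h2 γ; have := h2 s; have := h3 s
  field_simp

theorem rpow_scale_identity_right {ρ q t : ℝ} (hρ : 0 < ρ) (hq : 0 < q) (ht : 0 < t)
    (δ γ s : ℝ) :
    (ρ / q) ^ (δ - γ) * ((t / q) ^ γ * q ^ δ) =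
      (q ^ (s - γ) * ρ ^ (γ - δ))⁻¹ * t ^ s * (q / t) ^ (s - γ) := by
  rw [Real.div_rpow hρ.le hq.le, Real.div_rpow ht.le hq.le, Real.div_rpow hq.le ht.le]
  simp only [Real.rpow_sub hρ, Real.rpow_sub hq, Real.rpow_sub ht]
  have h1 := fun x : ℝ => (Real.rpow_pos_of_pos hρ x).ne'
  have h2 := fun x : ℝ => (Real.rpow_pos_of_pos hq x).ne'
  have h3 := fun x : ℝ => (Real.rpow_pos_of_pos ht x).ne'
  have := h1 δ; have := h1 γ; have := h2 δ; have := h2 γ; have := h2 s; have := h3 s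
  have := h3 γ
  field_simp

/-- The ball-mass bounds satisfied, at scales below `ρ`, by the measure of
`exists_level_measure`. -/
theorem level_mass_bound {δ γ s b D₀ c₂ ρ q t : ℝ} (hb : 0 < b) (hD₀ : 0 < D₀) (hc₂ : 0 < c₂)
    (hρ : 0 < ρ) (hq : 0 < q) (ht : 0 < t)
    {X : ℝ} (hX1 : t ≤ q → X ≤ D₀ * (ρ / q) ^ (δ - γ) * (b * t ^ δ))
    (hX2 : q ≤ t → X ≤ D₀ * (ρ / q) ^ (δ - γ) * (c₂ * (3 * t / q) ^ γ * (b * q ^ δ))) :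
    X ≤ D₀ * b * (1 + c₂ * 3 ^ γ) * (q ^ (s - γ) * ρ ^ (γ - δ))⁻¹ * t ^ s *
      (min (t / q) (q / t)) ^ min (δ - s) (s - γ) := by
  have hg : 0 < (q ^ (s - γ) * ρ ^ (γ - δ))⁻¹ := by positivity
  have h3 : (0 : ℝ) < 3 ^ γ := by positivity
  rcases le_total t q with h | h
  · have hmin : min (t / q) (q / t) = t / q :=
      min_eq_left (((div_le_one hq).2 h).trans ((one_le_div ht).2 h))
    rw [hmin]
    calc X ≤ D₀ * b * ((ρ / q) ^ (δ - γ) * t ^ δ) := by linarith [hX1 h]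
      _ = D₀ * b * 1 * (q ^ (s - γ) * ρ ^ (γ - δ))⁻¹ * t ^ s * (t / q) ^ (δ - s) := by
        rw [rpow_scale_identity_left hρ hq ht δ γ s]; ring
      _ ≤ _ := by
        gcongr ?_ * ?_ * ?_ * ?_ * ?_
        · linarith [mul_pos hc₂ h3]
        · exact Real.rpow_le_rpow_of_exponent_ge (div_pos ht hq) ((div_le_one hq).2 h)
            (min_le_left _ _)
  · have hmin : min (t / q) (q / t) = q / t :=
      min_eq_right (((div_le_one ht).2 h).trans ((one_le_div hq).2 h))
    rw [hmin]
    calc X ≤ D₀ * b * (c₂ * 3 ^ γ) * ((ρ / q) ^ (δ - γ) * ((t / q) ^ γ * q ^ δ)) := by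
          refine (hX2 h).trans (le_of_eq ?_)
          rw [mul_div_assoc, Real.mul_rpow (by norm_num) (div_pos ht hq).le]
          ring
      _ = D₀ * b * (c₂ * 3 ^ γ) * (q ^ (s - γ) * ρ ^ (γ - δ))⁻¹ * t ^ s * (q / t) ^ (s - γ) := by
        rw [rpow_scale_identity_right hρ hq ht δ γ s]; ring
      _ ≤ _ := by
        gcongr ?_ * ?_ * ?_ * ?_ * ?_
        · linarith
        · exact Real.rpow_le_rpow_of_exponent_ge (div_pos hq ht) ((div_le_one ht).2 h)
            (min_le_right _ _)

/-! ### The measure of a single level. -/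

/-- At a scale where the intersection conditions hold, there is a measure spread evenly, at scales
above `ρ`, over the `ρ`-neighbourhoods of the resonant sets, and carried by their
`q`-neighbourhoods. -/
theorem exists_level_measure {Ω J : Type*} [MetricSpace Ω] [CompactSpace Ω] [MeasurableSpace Ω]
    [BorelSpace Ω] (m : Measure Ω) [IsProbabilityMeasure m] (R : J → Set Ω) (I : Set J)
    {δ γ s a b r₀ c₁ c₂ ρ q : ℝ} (ha : 0 < a) (hb : 0 < b) (hc₁ : 0 < c₁) (hc₂ : 0 < c₂)
    (hm : ∀ (x : Ω) (r : ℝ), 0 < r → r ≤ r₀ →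
      ENNReal.ofReal (a * r ^ δ) ≤ m (Metric.ball x r) ∧
        m (Metric.ball x r) ≤ ENNReal.ofReal (b * r ^ δ))
    (hq : 0 < q) (hqρ : q ≤ ρ) (hρ : 4 * ρ ≤ r₀)
    (hint : ∀ α ∈ I, ∀ c ∈ R α, ∀ t : ℝ, 0 < t → t ≤ ρ →
      ENNReal.ofReal (c₁ * (ρ / t) ^ γ) * m (Metric.ball c t) ≤
          m (Metric.ball c (1 / 2 * ρ) ∩ Metric.thickening t (R α)) ∧
        ∀ α', ∀ y ∈ R α', ∀ r : ℝ, 0 < r → r ≤ 3 * ρ →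
          m (Metric.ball y r ∩ Metric.ball c (3 * ρ) ∩ Metric.thickening (3 * t) (R α)) ≤
            ENNReal.ofReal (c₂ * (r / t) ^ γ) * m (Metric.ball c t)) :
    ∃ (ν : Measure Ω) (A : Set Ω), IsClosed A ∧ A ⊆ ⋃ α ∈ I, Metric.cthickening q (R α) ∧
      ν Aᶜ = 0 ∧ (∃ M : ℝ≥0∞, M ≠ ∞ ∧ ν ≤ M • m) ∧
      (∀ x t, 0 < t → t ≤ ρ → ν (Metric.ball x t) ≤
        ENNReal.ofReal (b / (c₁ * a) * b * (1 + c₂ * 3 ^ γ) * (q ^ (s - γ) * ρ ^ (γ - δ))⁻¹ *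
          t ^ s * (min (t / q) (q / t)) ^ min (δ - s) (s - γ))) ∧
      (∀ x t, ρ ≤ t → 3 * t ≤ r₀ → ν (Metric.ball x t) ≤ ENNReal.ofReal (b * (3 * t) ^ δ)) ∧
      (∀ x r, 9 * ρ ≤ r → m (Metric.ball x (r / 2) ∩ ⋃ α ∈ I, Metric.thickening ρ (R α)) ≤
        ENNReal.ofReal (b * 4 ^ δ / a) * ν (Metric.ball x r)) := by
  have hρ0 : 0 < ρ := hq.trans_le hqρ
  obtain ⟨T, hTP, hsep, hcov⟩ := exists_finset_separated_cover {c | ∃ α ∈ I, c ∈ R α}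
    (show 0 < 3 * ρ by positivity)
  -- The resonant set is chosen instead of its index, since `J` may be empty and offer no default
  -- off `T`.
  choose! S hS using fun c (hc : c ∈ T) =>
    (show ∃ S : Set Ω, ∃ α ∈ I, c ∈ R α ∧ R α = S from
      let ⟨α, hα, hcα⟩ := hTP hc; ⟨R α, α, hα, hcα, rfl⟩)
  have hintS : ∀ c ∈ T,
      ENNReal.ofReal (c₁ * (ρ / q) ^ γ) * m (Metric.ball c q) ≤
          m (Metric.ball c (1 / 2 * ρ) ∩ Metric.thickening q (S c)) ∧
        ∀ y ∈ S c, ∀ r : ℝ, 0 < r → r ≤ 3 * ρ →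
          m (Metric.ball y r ∩ Metric.ball c (3 * ρ) ∩ Metric.thickening (3 * q) (S c)) ≤
            ENNReal.ofReal (c₂ * (r / q) ^ γ) * m (Metric.ball c q) := by
    intro c hc
    obtain ⟨α, hα, hcα, hαS⟩ := hS c hc
    rw [← hαS]
    exact ⟨(hint α hα c hcα q hq hqρ).1, (hint α hα c hcα q hq hqρ).2 α⟩
  set A : Ω → Set Ω := fun c => Metric.ball c (1 / 2 * ρ) ∩ Metric.thickening q (S c) with hA
  have hAm : ∀ c, MeasurableSet (A c) := fun c =>
    (Metric.isOpen_ball.inter Metric.isOpen_thickening).measurableSet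
  -- With this weight, `A c` carries exactly the mass `m (Metric.ball c ρ)`, so at scales above `ρ`
  -- the measure behaves like `m`.
  set w : Ω → ℝ≥0∞ := fun c => m (Metric.ball c ρ) / m (A c) with hw
  set D : ℝ := b / (c₁ * a) * (ρ / q) ^ (δ - γ) with hD
  have hApos : ∀ c ∈ T, ENNReal.ofReal (c₁ * (ρ / q) ^ γ * (a * q ^ δ)) ≤ m (A c) := by
    intro c hc
    refine le_trans ?_ (hintS c hc).1
    rw [ENNReal.ofReal_mul (by positivity)]
    gcongr
    exact (hm c q hq (by linarith)).1
  have hA0 : ∀ c ∈ T, m (A c) ≠ 0 := fun c hc =>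
    ((ENNReal.ofReal_pos.2 (by positivity)).trans_le (hApos c hc)).ne'
  have hwD : ∀ c ∈ T, w c ≤ ENNReal.ofReal D := by
    intro c hc
    have hDeq : D = (b * ρ ^ δ) / (c₁ * (ρ / q) ^ γ * (a * q ^ δ)) := by
      rw [hD, Real.rpow_sub (by positivity), Real.div_rpow hρ0.le hq.le, Real.div_rpow hρ0.le hq.le]
      field_simp
    rw [hDeq, ENNReal.ofReal_div_of_pos (by positivity)]
    exact ENNReal.div_le_div (hm c ρ hρ0 (by linarith)).2 (hApos c hc)
  have hwA : ∀ c ∈ T, w c * m (A c) = m (Metric.ball c ρ) := fun c hc =>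
    ENNReal.div_mul_cancel (hA0 c hc) (measure_ne_top _ _)
  have hAball : ∀ c, A c ⊆ Metric.ball c (1 / 2 * ρ) := fun c => Set.inter_subset_left
  set ν : Measure Ω := ∑ c ∈ T, w c • m.restrict (A c) with hν
  have hνE : ∀ E, ν E = ∑ c ∈ T, w c * m (E ∩ A c) := by
    intro E
    rw [hν, Measure.finsetSum_apply]
    refine Finset.sum_congr rfl fun c _ => ?_
    rw [Measure.smul_apply, Measure.restrict_apply' (hAm c), smul_eq_mul]
  refine ⟨ν, ⋃ c ∈ T, Metric.cthickening q (S c), ?_, ?_, ?_, ?_, ?_, ?_, ?_⟩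
  · exact isClosed_biUnion_finset fun _ _ => Metric.isClosed_cthickening
  · refine Set.iUnion₂_subset fun c hc => ?_
    obtain ⟨α, hα, -, hαS⟩ := hS c hc
    rw [← hαS]
    exact Set.subset_biUnion_of_mem (u := fun α => Metric.cthickening q (R α)) hα
  · rw [hνE]
    refine Finset.sum_eq_zero fun c hc => ?_
    rw [show (⋃ c ∈ T, Metric.cthickening q (S c))ᶜ ∩ A c = ∅ from ?_, measure_empty, mul_zero]
    refine Set.eq_empty_of_forall_notMem fun y hy => hy.1 ?_
    exact Set.mem_biUnion (Finset.mem_coe.2 hc) (Metric.thickening_subset_cthickening _ _ hy.2.2)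
  · refine ⟨∑ c ∈ T, ENNReal.ofReal D, by simp [ENNReal.mul_eq_top], ?_⟩
    intro E
    rw [hνE, Measure.smul_apply, smul_eq_mul, Finset.sum_mul]
    exact Finset.sum_le_sum fun c hc =>
      mul_le_mul' (hwD c hc) (measure_mono Set.inter_subset_left)
  · intro x t ht htρ
    -- A ball of radius at most `ρ` meets at most one `A c`: the centres are `3 * ρ` apart and `A c`
    -- lies within `ρ / 2` of `c`.
    by_cases hex : ∃ c ∈ T, (Metric.ball x t ∩ A c).Nonempty
    · obtain ⟨c, hc, z, hzx, hzA⟩ := hex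
      have hsum : ν (Metric.ball x t) = w c * m (Metric.ball x t ∩ A c) := by
        rw [hνE]
        refine Finset.sum_eq_single_of_mem c hc fun c' hc' hne => ?_
        rw [show Metric.ball x t ∩ A c' = ∅ from ?_, measure_empty, mul_zero]
        refine Set.eq_empty_of_forall_notMem fun z' hz' => ?_
        have h1 := hsep c' hc' c hc hne
        have h2 := Metric.mem_ball.1 (hAball c hzA)
        have h3 := Metric.mem_ball.1 (hAball c' hz'.2)
        have h4 := Metric.mem_ball.1 hzx
        have h5 := Metric.mem_ball.1 hz'.1
        have h6 := dist_triangle c' z' c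
        have h7 := dist_triangle z' z c
        have h8 := dist_triangle_right z' z x
        rw [dist_comm c' z'] at h6
        linarith
      have hfin : ν (Metric.ball x t) ≠ ∞ := by
        rw [hsum]
        exact ENNReal.mul_ne_top (ne_top_of_le_ne_top ENNReal.ofReal_ne_top (hwD c hc))
          (measure_ne_top _ _)
      rw [← ENNReal.ofReal_toReal hfin]
      refine ENNReal.ofReal_le_ofReal (level_mass_bound hb (by positivity) hc₂ hρ0 hq ht ?_ ?_)
      · intro _
        refine ENNReal.toReal_le_of_le_ofReal (by positivity) ?_
        rw [hsum, ← hD, ENNReal.ofReal_mul (by positivity)]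
        refine mul_le_mul' (hwD c hc) ((measure_mono Set.inter_subset_left).trans ?_)
        exact (hm x t ht (by linarith)).2
      · intro hqt
        refine ENNReal.toReal_le_of_le_ofReal (by positivity) ?_
        rw [hsum, ← hD, ENNReal.ofReal_mul (by positivity),
          ENNReal.ofReal_mul (p := c₂ * (3 * t / q) ^ γ) (by positivity)]
        refine mul_le_mul' (hwD c hc) ?_
        -- The intersection condition needs a ball centred on a resonant set: `y` is within `q ≤ t`
        -- of `z`, so radius `3 * t` around `y` suffices.
        obtain ⟨y, hy, hzy⟩ := Metric.mem_thickening_iff.1 hzA.2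
        refine le_trans (measure_mono ?_) (((hintS c hc).2 y hy
          (3 * t) (by positivity) (by linarith)).trans
          (mul_le_mul' le_rfl (hm c q hq (by linarith)).2))
        rintro p ⟨hp, hpA⟩
        refine ⟨⟨?_, ?_⟩, Metric.thickening_mono (by linarith) _ hpA.2⟩
        · have h1 := dist_triangle p z y
          have h2 := dist_triangle_right p z x
          rw [Metric.mem_ball] at hp hzx ⊢
          linarith
        · exact Metric.ball_subset_ball (by linarith) hpA.1
    · have : ν (Metric.ball x t) = 0 := by
        rw [hνE]
        refine Finset.sum_eq_zero fun c hc => ?_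
        rw [Set.not_nonempty_iff_eq_empty.1 fun h => hex ⟨c, hc, h⟩, measure_empty, mul_zero]
      rw [this]
      exact zero_le
  · intro x t hρt ht
    classical
    -- Each `A c` met is charged to the disjoint ball of radius `ρ` about `c`, and all these balls
    -- lie in the ball of radius `3 * t`.
    have h1 : ν (Metric.ball x t) ≤
        ∑ c ∈ T.filter fun c => (Metric.ball x t ∩ A c).Nonempty, m (Metric.ball c ρ) := by
      rw [hνE, Finset.sum_filter]
      refine Finset.sum_le_sum fun c hc => ?_
      split_ifs with h
      · rw [← hwA c hc]
        gcongr
        exact Set.inter_subset_right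
      · rw [Set.not_nonempty_iff_eq_empty.1 h, measure_empty, mul_zero]
    refine h1.trans ?_
    rw [← measure_biUnion_finset]
    · refine (measure_mono ?_).trans (hm x (3 * t) (by linarith) ht).2
      refine Set.iUnion₂_subset fun c hc p hp => ?_
      obtain ⟨z, hzx, hzA⟩ := (Finset.mem_filter.1 hc).2
      have h2 := Metric.mem_ball.1 (hAball c hzA)
      have h3 := dist_triangle4 p c z x
      rw [dist_comm c z] at h3
      rw [Metric.mem_ball] at hp hzx ⊢
      linarith
    · intro c hc c' hc' hne
      refine Metric.ball_disjoint_ball ?_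
      have := hsep c (Finset.mem_filter.1 hc).1 c' (Finset.mem_filter.1 hc').1 hne
      linarith
    · exact fun c _ => Metric.isOpen_ball.measurableSet
  · intro x r hr
    classical
    -- A point of the left side is within `4 * ρ` of a centre `c`, and `A c` adds `ρ / 2`; the
    -- requirement `9 * ρ ≤ r` keeps `A c` in the larger ball. Passing from radius `4 * ρ` to `ρ`
    -- costs `b * 4 ^ δ / a`.
    have h1 : Metric.ball x (r / 2) ∩ ⋃ α ∈ I, Metric.thickening ρ (R α) ⊆
        ⋃ c ∈ T.filter fun c => A c ⊆ Metric.ball x r, Metric.ball c (4 * ρ) := by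
      rintro y ⟨hyx, hy⟩
      obtain ⟨i, hi, hyi⟩ := Set.mem_iUnion₂.1 hy
      obtain ⟨c', hc', hyc'⟩ := Metric.mem_thickening_iff.1 hyi
      obtain ⟨c, hc, hcc'⟩ := hcov c' ⟨i, hi, hc'⟩
      have h2 := dist_triangle y c' c
      refine Set.mem_biUnion (x := c) (Finset.mem_coe.2 (Finset.mem_filter.2 ⟨hc, ?_⟩)) ?_
      · intro z hz
        have h3 := Metric.mem_ball.1 (hAball c hz)
        have h4 := dist_triangle4 z c y x
        rw [dist_comm c y] at h4
        rw [Metric.mem_ball] at hyx ⊢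
        linarith
      · rw [Metric.mem_ball]
        linarith
    refine (measure_mono h1).trans ((measure_biUnion_finset_le _ _).trans ?_)
    rw [hνE, Finset.mul_sum, Finset.sum_filter]
    refine Finset.sum_le_sum fun c hc => ?_
    split_ifs with h
    · rw [Set.inter_eq_right.2 h, hwA c hc]
      refine (hm c (4 * ρ) (by positivity) hρ).2.trans
        (le_trans (le_of_eq ?_) (mul_le_mul' le_rfl (hm c ρ hρ0 (by linarith)).1))
      rw [← ENNReal.ofReal_mul (by positivity), Real.mul_rpow (by norm_num) hρ0.le]
      congr 1
      field_simp
    · exact zero_le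

/-! ### Superposition of levels. -/

/-- Superposing measures at geometrically separated scales with divergent weights improves the
bound on small balls. -/
theorem exists_superposed_measure {Ω : Type*} [MetricSpace Ω] [MeasurableSpace Ω]
    {m : Measure Ω} {q ρ g : ℕ → ℝ} {θ e s δ K₁ K₂ t₀ : ℝ} (hq : ∀ i, 0 < q i) (hθ0 : 0 < θ)
    (hθ1 : θ < 1) (hstep : ∀ i, q (i + 1) ≤ θ * q i) (he : 0 < e) (hg : ∀ i, 0 < g i)
    (hsum : ¬ Summable g) (hK₁ : 0 ≤ K₁) (hK₂ : 0 ≤ K₂) {ν : ℕ → Measure Ω} {A O : ℕ → Set Ω}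
    (hAc : ∀ i, IsClosed (A i)) (hAO : ∀ i, A i ⊆ O i) (hA0 : ∀ i, ν i (A i)ᶜ = 0)
    (hνm : ∀ i, ∃ M : ℝ≥0∞, M ≠ ∞ ∧ ν i ≤ M • m)
    (hsmall : ∀ i x t, 0 < t → t ≤ ρ i → ν i (Metric.ball x t) ≤
      ENNReal.ofReal (K₁ * (g i)⁻¹ * t ^ s * (min (t / q i) (q i / t)) ^ e))
    (hlarge : ∀ i x t, ρ i ≤ t → t ≤ t₀ → ν i (Metric.ball x t) ≤ ENNReal.ofReal (K₂ * t ^ δ))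
    {ε : ℝ} (hε : 0 < ε) (N : ℕ) :
    ∃ (ν' : Measure Ω) (B : Set Ω), IsClosed B ∧ B ⊆ ⋃ i ≥ N, O i ∧ ν' Bᶜ = 0 ∧
      (∃ M : ℝ≥0∞, M ≠ ∞ ∧ ν' ≤ M • m) ∧
      (∀ x t, 0 < t → t ≤ t₀ →
        ν' (Metric.ball x t) ≤ ENNReal.ofReal (ε * t ^ s + K₂ * t ^ δ)) ∧
      ∀ (c : ℝ≥0∞) (E : Set Ω), (∀ i ≥ N, c ≤ ν i E) → c ≤ ν' E := by
  set C : ℝ := K₁ * (2 * (1 - θ ^ e)⁻¹) with hC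
  have hC0 : 0 ≤ C := by
    have : θ ^ e < 1 := Real.rpow_lt_one hθ0.le hθ1 he
    have : 0 < (1 - θ ^ e)⁻¹ := inv_pos.2 (by linarith)
    positivity
  obtain ⟨F, hFN, hFW⟩ : ∃ F : Finset ℕ, (∀ i ∈ F, N ≤ i) ∧ (C + 1) / ε ≤ ∑ i ∈ F, g i := by
    have := (not_summable_iff_tendsto_nat_atTop_of_nonneg fun i => (hg i).le).1 hsum
    obtain ⟨k, hk, hkN⟩ := ((this.eventually_ge_atTop
      ((C + 1) / ε + ∑ i ∈ Finset.range N, g i)).and (eventually_ge_atTop N)).exists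
    refine ⟨Finset.Ico N k, fun i hi => (Finset.mem_Ico.1 hi).1, ?_⟩
    rw [Finset.sum_Ico_eq_sub _ hkN]
    linarith
  set W := ∑ i ∈ F, g i with hW
  have hWpos : 0 < W := lt_of_lt_of_le (by positivity) hFW
  have hCW : C / W ≤ ε := by
    rw [div_le_iff₀ hWpos]
    rw [div_le_iff₀ hε] at hFW
    linarith
  choose M hM hνM using hνm
  -- The weight `g i / W` cancels `(g i)⁻¹` in the small-scale bound, leaving `K₁ / W * t ^ s` times
  -- a sum bounded independently of `F`.
  set ν' : Measure Ω := ∑ i ∈ F, ENNReal.ofReal (g i / W) • ν i with hν'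
  have hν'E : ∀ E, ν' E = ∑ i ∈ F, ENNReal.ofReal (g i / W) * ν i E := by
    intro E
    rw [hν', Measure.finsetSum_apply]
    rfl
  have hgW : ∀ i, 0 ≤ g i / W := fun i => (div_pos (hg i) hWpos).le
  have hone : ∑ i ∈ F, g i / W = 1 := by rw [← Finset.sum_div, div_self hWpos.ne']
  refine ⟨ν', ⋃ i ∈ F, A i, isClosed_biUnion_finset fun i _ => hAc i, ?_, ?_, ?_, ?_, ?_⟩
  · exact Set.iUnion₂_subset fun i hi => (hAO i).trans
      (Set.subset_biUnion_of_mem (u := fun i => O i) (hFN i hi))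
  · rw [hν'E]
    refine Finset.sum_eq_zero fun i hi => ?_
    have h : ν i (⋃ i ∈ F, A i)ᶜ = 0 := measure_mono_null (Set.compl_subset_compl.2
      (Set.subset_biUnion_of_mem (u := fun i => A i) (Finset.mem_coe.2 hi))) (hA0 i)
    rw [h, mul_zero]
  · refine ⟨∑ i ∈ F, ENNReal.ofReal (g i / W) * M i,
      ENNReal.sum_ne_top.2 fun i _ => ENNReal.mul_ne_top ENNReal.ofReal_ne_top (hM i), ?_⟩
    intro E
    rw [hν'E, Measure.smul_apply, smul_eq_mul, Finset.sum_mul]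
    refine Finset.sum_le_sum fun i _ => ?_
    rw [mul_assoc]
    exact mul_le_mul' le_rfl (hνM i E)
  · intro x t ht htt
    have hmin : ∀ i, 0 ≤ (min (t / q i) (q i / t)) ^ e := fun i =>
      Real.rpow_nonneg (le_min (div_pos ht (hq i)).le (div_pos (hq i) ht).le) _
    have hts : 0 < t ^ s := Real.rpow_pos_of_pos ht s
    have htδ : 0 < t ^ δ := Real.rpow_pos_of_pos ht δ
    have hnn : ∀ i, 0 ≤ K₁ * (g i)⁻¹ * t ^ s * (min (t / q i) (q i / t)) ^ e := fun i =>
      mul_nonneg (mul_nonneg (mul_nonneg hK₁ (inv_nonneg.2 (hg i).le)) hts.le) (hmin i)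
    calc ν' (Metric.ball x t)
        ≤ ∑ i ∈ F, ENNReal.ofReal (g i / W *
            (K₁ * (g i)⁻¹ * t ^ s * (min (t / q i) (q i / t)) ^ e + K₂ * t ^ δ)) := by
          rw [hν'E]
          refine Finset.sum_le_sum fun i _ => ?_
          rw [ENNReal.ofReal_mul (hgW i)]
          refine mul_le_mul' le_rfl ?_
          rcases le_total t (ρ i) with h | h
          · refine (hsmall i x t ht h).trans (ENNReal.ofReal_le_ofReal ?_)
            linarith [mul_nonneg hK₂ htδ.le]
          · refine (hlarge i x t h htt).trans (ENNReal.ofReal_le_ofReal ?_)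
            linarith [hnn i]
      _ = ENNReal.ofReal (∑ i ∈ F, g i / W *
            (K₁ * (g i)⁻¹ * t ^ s * (min (t / q i) (q i / t)) ^ e + K₂ * t ^ δ)) := by
          rw [ENNReal.ofReal_sum_of_nonneg]
          intro i _
          exact mul_nonneg (hgW i) (add_nonneg (hnn i) (mul_nonneg hK₂ htδ.le))
      _ = ENNReal.ofReal (K₁ / W * t ^ s * (∑ i ∈ F, (min (t / q i) (q i / t)) ^ e) +
            K₂ * t ^ δ) := by
          congr 1
          simp only [mul_add, Finset.sum_add_distrib]
          rw [← Finset.sum_mul, hone, one_mul, Finset.mul_sum]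
          congr 1
          refine Finset.sum_congr rfl fun i _ => ?_
          have := (hg i).ne'
          field_simp
      _ ≤ _ := by
          refine ENNReal.ofReal_le_ofReal (add_le_add ?_ le_rfl)
          have h1 := sum_min_ratio_rpow_le hq hθ0 hθ1 hstep he ht F
          calc _ ≤ K₁ / W * t ^ s * (2 * (1 - θ ^ e)⁻¹) := by gcongr
            _ = C / W * t ^ s := by rw [hC]; ring
            _ ≤ ε * t ^ s := by gcongr
  · intro c E hc
    calc c = ∑ i ∈ F, ENNReal.ofReal (g i / W) * c := by
          rw [← Finset.sum_mul, ← ENNReal.ofReal_sum_of_nonneg (fun i _ => hgW i), hone,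
            ENNReal.ofReal_one, one_mul]
      _ ≤ _ := by
          rw [hν'E]
          exact Finset.sum_le_sum fun i hi => mul_le_mul' le_rfl (hc i (hFN i hi))

/-! ### Transport of mass and the refinement step. -/

theorem exists_measurable_disjointed_finset {Ω : Type*} [MeasurableSpace Ω] (X : Finset Ω)
    (U : Ω → Set Ω) (hU : ∀ c, MeasurableSet (U c)) :
    ∃ Q : Ω → Set Ω, (∀ c, MeasurableSet (Q c)) ∧ (∀ c, Q c ⊆ U c) ∧
      (X : Set Ω).PairwiseDisjoint Q ∧ ⋃ c ∈ X, Q c = ⋃ c ∈ X, U c := by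
  classical
  induction X using Finset.induction_on with
  | empty => exact ⟨U, hU, fun _ => le_rfl, by simp, by simp⟩
  | insert a X ha ih =>
    obtain ⟨Q, hQm, hQU, hQd, hQX⟩ := ih
    have hne : ∀ c ∈ X, c ≠ a := fun c hc h => ha (h ▸ hc)
    have hQ' : ∀ c ∈ X, Function.update Q a (U a \ ⋃ c ∈ X, U c) c = Q c := fun c hc =>
      Function.update_of_ne (hne c hc) _ _
    refine ⟨Function.update Q a (U a \ ⋃ c ∈ X, U c), ?_, ?_, ?_, ?_⟩
    · intro c
      rcases eq_or_ne c a with rfl | h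
      · rw [Function.update_self]
        exact (hU c).diff (X.measurableSet_biUnion fun c _ => hU c)
      · rw [Function.update_of_ne h]; exact hQm c
    · intro c
      rcases eq_or_ne c a with rfl | h
      · rw [Function.update_self]; exact Set.sdiff_subset
      · rw [Function.update_of_ne h]; exact hQU c
    · rw [Finset.coe_insert, Set.pairwiseDisjoint_insert]
      refine ⟨fun c hc c' hc' h => ?_, fun c hc _ => ?_⟩
      · simp only [Function.onFun]
        rw [hQ' c hc, hQ' c' hc']
        exact hQd hc hc' h
      · rw [Function.update_self, hQ' c hc]
        exact Set.disjoint_left.2 fun y hy hyc => hy.2 (Set.mem_biUnion hc (hQU c hyc))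
    · rw [Finset.set_biUnion_insert, Finset.set_biUnion_insert, Function.update_self,
        Set.iUnion₂_congr hQ', hQX, Set.sdiff_union_self]

/-- The mass of a probability measure, dominated by `m`, is moved by at most `τ` onto another
measure which charges small balls at least as much as `m` does. -/
theorem exists_transported_measure {Ω : Type*} [MetricSpace Ω] [MeasurableSpace Ω] [BorelSpace Ω]
    {m μ ν : Measure Ω} [IsProbabilityMeasure μ] {M Mν K : ℝ≥0∞} (hμ : μ ≤ M • m)
    (hMν : Mν ≠ ∞) (hν : ν ≤ Mν • m) [IsFiniteMeasure m] {X : Finset Ω} {r τ : ℝ}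
    (hτ : 3 * r ≤ τ)
    (hsep : ∀ c ∈ X, ∀ c' ∈ X, c ≠ c' → 2 * r ≤ dist c c') (hcov : ∀ y, ∃ c ∈ X, dist y c < 2 * r)
    (hball : ∀ c ∈ X, m (Metric.ball c (2 * r)) ≤ K * ν (Metric.ball c r))
    (hpos : ∀ c ∈ X, m (Metric.ball c (2 * r)) ≠ 0) :
    ∃ μ' : Measure Ω, IsProbabilityMeasure μ' ∧ μ' ≤ (M * K * Mν) • m ∧
      (∀ E, MeasurableSet E → μ' E ≤ M * K * ν E) ∧
      ∀ E, μ' E ≤ μ (Metric.thickening τ E) := by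
  classical
  obtain ⟨Q, hQm, hQU, hQd, hQX⟩ := exists_measurable_disjointed_finset X
    (fun c => Metric.ball c (2 * r)) fun c => Metric.isOpen_ball.measurableSet
  have hQuniv : ⋃ c ∈ X, Q c = Set.univ := by
    rw [hQX]
    refine Set.eq_univ_of_forall fun y => ?_
    obtain ⟨c, hc, hy⟩ := hcov y
    exact Set.mem_biUnion (Finset.mem_coe.2 hc) hy
  have hν0 : ∀ c ∈ X, ν (Metric.ball c r) ≠ 0 := fun c hc h => hpos c hc <| by
    have := hball c hc
    rwa [h, mul_zero, nonpos_iff_eq_zero] at this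
  have hνtop : ∀ E, ν E ≠ ∞ := fun E =>
    ne_top_of_le_ne_top (ENNReal.mul_ne_top hMν (measure_ne_top m E)) (hν E)
  -- The mass of the cell `Q c` is redistributed over the ball of radius `r` about `c`,
  -- proportionally to `ν`. Cells reach at most `2 * r` from `c`, so the displacement is below `3 *
  -- r ≤ τ`.
  set w : Ω → ℝ≥0∞ := fun c => μ (Q c) / ν (Metric.ball c r) with hw
  have hwν : ∀ c ∈ X, w c * ν (Metric.ball c r) = μ (Q c) := fun c hc =>
    ENNReal.div_mul_cancel (hν0 c hc) (hνtop _)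
  have hwK : ∀ c ∈ X, w c ≤ M * K := by
    intro c hc
    refine ENNReal.div_le_of_le_mul ?_
    calc μ (Q c) ≤ M * m (Metric.ball c (2 * r)) :=
          (hμ _).trans (mul_le_mul' le_rfl (measure_mono (hQU c)))
      _ ≤ M * (K * ν (Metric.ball c r)) := mul_le_mul' le_rfl (hball c hc)
      _ = _ := by ring
  set μ' : Measure Ω := ∑ c ∈ X, w c • ν.restrict (Metric.ball c r) with hμ'
  have hμ'E : ∀ E, μ' E = ∑ c ∈ X, w c * ν (E ∩ Metric.ball c r) := by
    intro E
    rw [hμ', Measure.finsetSum_apply]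
    refine Finset.sum_congr rfl fun c _ => ?_
    rw [Measure.smul_apply, Measure.restrict_apply' Metric.isOpen_ball.measurableSet, smul_eq_mul]
  have hle : ∀ E, MeasurableSet E → μ' E ≤ M * K * ν E := by
    intro E hE
    calc μ' E ≤ ∑ c ∈ X, M * K * ν (E ∩ Metric.ball c r) := by
          rw [hμ'E]
          exact Finset.sum_le_sum fun c hc => mul_le_mul' (hwK c hc) le_rfl
      _ = M * K * ν (⋃ c ∈ X, E ∩ Metric.ball c r) := by
          rw [← Finset.mul_sum, measure_biUnion_finset]
          · intro c hc c' hc' hne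
            refine Disjoint.mono Set.inter_subset_right Set.inter_subset_right
              (Metric.ball_disjoint_ball ?_)
            linarith [hsep c hc c' hc' hne]
          · exact fun c _ => hE.inter Metric.isOpen_ball.measurableSet
      _ ≤ M * K * ν E := by
          gcongr
          exact Set.iUnion₂_subset fun _ _ => Set.inter_subset_left
  refine ⟨μ', ⟨?_⟩, ?_, hle, ?_⟩
  · rw [hμ'E]
    simp only [Set.univ_inter]
    rw [Finset.sum_congr rfl hwν, ← measure_biUnion_finset hQd fun c _ => hQm c, hQuniv,
      measure_univ]
  · refine Measure.le_iff.2 fun E hE => (hle E hE).trans ?_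
    rw [Measure.smul_apply, smul_eq_mul, mul_assoc (M * K)]
    exact mul_le_mul' le_rfl (hν E)
  · intro E
    calc μ' E ≤ ∑ c ∈ X.filter fun c => (E ∩ Metric.ball c r).Nonempty, μ (Q c) := by
          rw [hμ'E, Finset.sum_filter]
          refine Finset.sum_le_sum fun c hc => ?_
          split_ifs with h
          · rw [← hwν c hc]
            exact mul_le_mul' le_rfl (measure_mono Set.inter_subset_right)
          · rw [Set.not_nonempty_iff_eq_empty.1 h, measure_empty, mul_zero]
      _ = μ (⋃ c ∈ X.filter fun c => (E ∩ Metric.ball c r).Nonempty, Q c) := by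
          rw [measure_biUnion_finset]
          · exact hQd.subset fun c hc => (Finset.mem_filter.1 hc).1
          · exact fun c _ => hQm c
      _ ≤ _ := by
          refine measure_mono (Set.iUnion₂_subset fun c hc y hy => ?_)
          obtain ⟨z, hzE, hzc⟩ := (Finset.mem_filter.1 hc).2
          refine Metric.mem_thickening_iff.2 ⟨z, hzE, ?_⟩
          have h1 := Metric.mem_ball.1 (hQU c hy)
          have h2 := dist_triangle_right y z c
          rw [Metric.mem_ball] at hzc
          linarith

theorem exists_pos_forall_mul_rpow_le {C η e : ℝ} (hη : 0 < η) (he : 0 < e) :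
    ∃ r > 0, ∀ t : ℝ, 0 < t → t ≤ r → C * t ^ e ≤ η := by
  have h : Tendsto (fun t : ℝ => C * t ^ e) (𝓝 0) (𝓝 (C * 0 ^ e)) :=
    ((Real.continuousAt_rpow_const 0 e (Or.inr he.le)).tendsto).const_mul C
  rw [Real.zero_rpow he.ne', mul_zero] at h
  obtain ⟨r, hr, hball⟩ := Metric.eventually_nhds_iff.1 (h.eventually (ge_mem_nhds hη))
  refine ⟨r / 2, half_pos hr, fun t ht htr => hball ?_⟩
  rw [Real.dist_eq, sub_zero, abs_of_pos ht]
  linarith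

/-- One step of the iteration: the mass of a measure dominated by `m` is moved onto `⋃ i ≥ N, O i`
by an arbitrarily small distance, with a bound on small balls at scales up to a radius `r` which
does not depend on that distance. -/
theorem exists_refining_measure {Ω : Type*} [MetricSpace Ω] [CompactSpace Ω] [MeasurableSpace Ω]
    [BorelSpace Ω] {m : Measure Ω} [IsFiniteMeasure m] {q ρ g : ℕ → ℝ}
    {θ e s δ K₁ K₂ K₃ t₀ : ℝ} (hq : ∀ i, 0 < q i) (hθ0 : 0 < θ)
    (hθ1 : θ < 1) (hstep : ∀ i, q (i + 1) ≤ θ * q i) (he : 0 < e) (hg : ∀ i, 0 < g i)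
    (hsum : ¬ Summable g) (hK₁ : 0 ≤ K₁) (hK₂ : 0 ≤ K₂) {ν : ℕ → Measure Ω} {A O : ℕ → Set Ω}
    (hAc : ∀ i, IsClosed (A i)) (hAO : ∀ i, A i ⊆ O i) (hA0 : ∀ i, ν i (A i)ᶜ = 0)
    (hνm : ∀ i, ∃ M : ℝ≥0∞, M ≠ ∞ ∧ ν i ≤ M • m)
    (hsmall : ∀ i x t, 0 < t → t ≤ ρ i → ν i (Metric.ball x t) ≤
      ENNReal.ofReal (K₁ * (g i)⁻¹ * t ^ s * (min (t / q i) (q i / t)) ^ e))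
    (hlarge : ∀ i x t, ρ i ≤ t → t ≤ t₀ → ν i (Metric.ball x t) ≤ ENNReal.ofReal (K₂ * t ^ δ))
    (ht₀ : 0 < t₀) (hsδ : s < δ) (hmpos : ∀ x r, 0 < r → m (Metric.ball x r) ≠ 0)
    (hub : ∀ x r, 0 < r → r ≤ t₀ → ∀ᶠ i in atTop,
      m (Metric.ball x (2 * r)) ≤ ENNReal.ofReal K₃ * ν i (Metric.ball x r))
    {ε : ℝ} (hε : 0 < ε) {μ : Measure Ω}
    (hμ : IsProbabilityMeasure μ ∧ ∃ M : ℝ≥0∞, M ≠ ∞ ∧ μ ≤ M • m) :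
    ∃ r > 0, ∀ τ > 0, ∀ N : ℕ, ∃ (μ' : Measure Ω) (B : Set Ω),
      (IsProbabilityMeasure μ' ∧ ∃ M : ℝ≥0∞, M ≠ ∞ ∧ μ' ≤ M • m) ∧ IsClosed B ∧
      B ⊆ ⋃ i ≥ N, O i ∧ μ' Bᶜ = 0 ∧
      (∀ x t, 0 < t → t ≤ r → μ' (Metric.ball x t) ≤ ENNReal.ofReal (ε * t ^ s)) ∧
      ∀ E, μ' E ≤ μ (Metric.thickening τ E) := by
  obtain ⟨hprob, M, hM, hμM⟩ := hμ
  have hMK : M * ENNReal.ofReal K₃ ≠ ∞ := ENNReal.mul_ne_top hM ENNReal.ofReal_ne_top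
  obtain ⟨L, hL0, hL⟩ : ∃ L : ℝ, 0 ≤ L ∧ M * ENNReal.ofReal K₃ = ENNReal.ofReal L :=
    ⟨_, ENNReal.toReal_nonneg, (ENNReal.ofReal_toReal hMK).symm⟩
  -- This radius absorbs the `t ^ δ` term into `ε / 2 * t ^ s`. It depends on the density bound of
  -- `μ` through `L`, but is fixed before `τ` and `N`, as the iteration requires.
  obtain ⟨r, hr, hrle⟩ := exists_pos_forall_mul_rpow_le (C := L * K₂) (half_pos hε)
    (sub_pos.2 hsδ)
  refine ⟨min r t₀, lt_min hr ht₀, fun τ hτ N => ?_⟩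
  set r' := min (τ / 3) t₀ with hr'
  have hr'0 : 0 < r' := lt_min (by positivity) ht₀
  obtain ⟨X, -, hsep, hcov⟩ := exists_finset_separated_cover (Set.univ : Set Ω)
    (show 0 < 2 * r' by positivity)
  -- The threshold in `hub` depends on the ball; finiteness of the net makes it common.
  have hev : ∀ᶠ i in atTop, ∀ x ∈ X,
      m (Metric.ball x (2 * r')) ≤ ENNReal.ofReal K₃ * ν i (Metric.ball x r') :=
    (Finset.eventually_all X).2 fun x _ => hub x r' hr'0 (min_le_right _ _)
  obtain ⟨N', hN'⟩ := eventually_atTop.1 hev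
  obtain ⟨ν', B, hBc, hBO, hB0, ⟨Mν, hMν, hν'⟩, hball, hlow⟩ :=
    exists_superposed_measure hq hθ0 hθ1 hstep he hg hsum hK₁ hK₂ hAc hAO hA0 hνm hsmall hlarge
      (show 0 < ε / (2 * (L + 1)) by positivity) (max N N')
  obtain ⟨μ', hμ'p, hμ'm, hμ'ν, hμ'τ⟩ := exists_transported_measure (m := m) (μ := μ) (ν := ν')
    hμM hMν hν' (K := ENNReal.ofReal K₃) (X := X) (r := r') (τ := τ)
    (by linarith [min_le_left (τ / 3) t₀]) hsep (fun y => hcov y trivial)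
    (fun x hx => by
      rcases le_or_gt K₃ 0 with hK | hK
      · have := hN' N' le_rfl x hx
        rw [ENNReal.ofReal_of_nonpos hK, zero_mul] at this ⊢
        exact this
      · have hK0 : ENNReal.ofReal K₃ ≠ 0 := (ENNReal.ofReal_pos.2 hK).ne'
        have := hlow (m (Metric.ball x (2 * r')) / ENNReal.ofReal K₃) (Metric.ball x r')
          fun i hi => ENNReal.div_le_of_le_mul'
            (hN' i ((le_max_right _ _).trans hi) x hx)
        rwa [ENNReal.div_le_iff' hK0 ENNReal.ofReal_ne_top] at this)
    (fun x _ => hmpos x _ (by positivity))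
  refine ⟨μ', B, ⟨hμ'p, _, ENNReal.mul_ne_top hMK hMν, hμ'm⟩, hBc, hBO.trans ?_, ?_, ?_, hμ'τ⟩
  · exact Set.biUnion_subset_biUnion_left fun i hi => (le_max_left N N').trans hi
  · have := hμ'ν Bᶜ hBc.measurableSet.compl
    rwa [hB0, mul_zero, nonpos_iff_eq_zero] at this
  · intro x t ht htr
    refine (hμ'ν _ Metric.isOpen_ball.measurableSet).trans ?_
    rw [hL]
    refine (mul_le_mul' le_rfl (hball x t ht (htr.trans (min_le_right _ _)))).trans ?_
    rw [← ENNReal.ofReal_mul hL0]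
    refine ENNReal.ofReal_le_ofReal ?_
    have hts : 0 < t ^ s := Real.rpow_pos_of_pos ht s
    have h1 := hrle t ht (htr.trans (min_le_left _ _))
    have h2 : t ^ δ = t ^ (δ - s) * t ^ s := by rw [← Real.rpow_add ht]; congr 1; ring
    have h3 : L * (ε / (2 * (L + 1))) ≤ ε / 2 := by
      rw [mul_div_assoc', div_le_div_iff₀ (by positivity) (by positivity)]
      nlinarith
    calc L * (ε / (2 * (L + 1)) * t ^ s + K₂ * t ^ δ)
        = (L * (ε / (2 * (L + 1))) + L * K₂ * t ^ (δ - s)) * t ^ s := by rw [h2]; ring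
      _ ≤ (ε / 2 + ε / 2) * t ^ s := by gcongr
      _ = ε * t ^ s := by ring

/-! ### Iteration and the mass distribution principle. -/

/-- If the refinement step is available for all `ε`, the limsup set has infinite Hausdorff
measure. -/
theorem hausdorffMeasure_eq_top_of_refining {Ω : Type*} [MetricSpace Ω] [CompactSpace Ω]
    [MeasurableSpace Ω] [BorelSpace Ω] {m : Measure Ω} [IsProbabilityMeasure m] {O : ℕ → Set Ω}
    (hO : ∀ i, IsOpen (O i)) {s : ℝ} (hs : 0 < s)
    (hrefine : ∀ ε > 0, ∀ μ : Measure Ω,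
      (IsProbabilityMeasure μ ∧ ∃ M : ℝ≥0∞, M ≠ ∞ ∧ μ ≤ M • m) →
      ∃ r > 0, ∀ τ > 0, ∀ N : ℕ, ∃ (μ' : Measure Ω) (B : Set Ω),
        (IsProbabilityMeasure μ' ∧ ∃ M : ℝ≥0∞, M ≠ ∞ ∧ μ' ≤ M • m) ∧ IsClosed B ∧
        B ⊆ ⋃ i ≥ N, O i ∧ μ' Bᶜ = 0 ∧
        (∀ x t, 0 < t → t ≤ r → μ' (Metric.ball x t) ≤ ENNReal.ofReal (ε * t ^ s)) ∧
        ∀ E, μ' E ≤ μ (Metric.thickening τ E)) :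
    Measure.hausdorffMeasure s (⋂ N : ℕ, ⋃ i ≥ N, O i) = ∞ := by
  have hOo : ∀ N : ℕ, IsOpen (⋃ i ≥ N, O i) := fun N => isOpen_biUnion fun i _ => hO i
  have main : ∀ ε > 0, ∃ ν : Measure Ω, IsProbabilityMeasure ν ∧
      ν (⋂ N : ℕ, ⋃ i ≥ N, O i)ᶜ = 0 ∧ ∃ e₀ > 0, ∀ x t, 0 < t → t ≤ e₀ →
        ν (Metric.ball x t) ≤ ENNReal.ofReal (ε * (2 * t) ^ s) := by
    intro ε hε
    choose! r hr hnext using hrefine ε hε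
    -- The clause `2 * p.2 ≤ r p.1` is there because the limit argument evaluates the next measure
    -- on balls of radius `2 * t` with `t ≤ p.2`.
    let P : Measure Ω × ℝ → Prop := fun p =>
      (IsProbabilityMeasure p.1 ∧ ∃ M : ℝ≥0∞, M ≠ ∞ ∧ p.1 ≤ M • m) ∧ 0 < p.2 ∧ 2 * p.2 ≤ r p.1
    have hex : ∀ (k : ℕ) (p : {p // P p}), ∃ (p' : {p // P p}) (B : Set Ω),
        p'.1.1 Bᶜ = 0 ∧ Metric.cthickening p'.1.2 B ⊆ ⋃ i ≥ k, O i ∧ p'.1.2 ≤ p.1.2 / 2 ∧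
        (∀ x t, 0 < t → t ≤ r p.1.1 →
          p'.1.1 (Metric.ball x t) ≤ ENNReal.ofReal (ε * t ^ s)) ∧
        ∀ E, p'.1.1 E ≤ p.1.1 (Metric.thickening (p.1.2 / 2) E) := by
      rintro k ⟨⟨μ, e⟩, hμ, he, her⟩
      obtain ⟨μ', B, hμ', hBc, hBO, hB0, hball, hE⟩ := hnext μ hμ (e / 2) (half_pos he) k
      obtain ⟨χ, hχ, hχO⟩ := hBc.isCompact.exists_cthickening_subset_open (hOo k) hBO
      have hr' := hr μ' hμ'
      refine ⟨⟨⟨μ', min (min (e / 2) χ) (r μ' / 2)⟩, hμ', ?_, ?_⟩, B, hB0, ?_, ?_, hball, hE⟩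
      · exact lt_min (lt_min (half_pos he) hχ) (half_pos hr')
      · linarith [min_le_right (min (e / 2) χ) (r μ' / 2)]
      · exact (Metric.cthickening_mono ((min_le_left _ _).trans (min_le_right _ _)) _).trans hχO
      · exact (min_le_left _ _).trans (min_le_left _ _)
    choose next B hB0 hBO hhalf hball hE using hex
    have hm : IsProbabilityMeasure m ∧ ∃ M : ℝ≥0∞, M ≠ ∞ ∧ m ≤ M • m :=
      ⟨inferInstance, 1, ENNReal.one_ne_top, by rw [one_smul]⟩
    have hrm := hr m hm
    let p₀ : {p // P p} := ⟨(m, r m / 2), hm, half_pos hrm, by simp; linarith⟩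
    let σ : ℕ → {p // P p} := fun k => Nat.rec p₀ (fun k p => next k p) k
    have : ∀ k, IsProbabilityMeasure (σ k).1.1 := fun k => (σ k).2.1.1
    obtain ⟨ν, hν, hν0, hνball⟩ := exists_limit_measure (fun k => (σ k).1.1) (fun k => (σ k).1.2)
      (fun k => (σ k).2.2.1) (fun k => hhalf k (σ k))
      (fun t => ENNReal.ofReal (ε * (2 * t) ^ s)) (fun k => hE k (σ k))
      (fun k x t ht hte => hball k (σ k) x (2 * t) (by positivity)
        (le_trans (by linarith) (σ k).2.2.2))
      (fun k => B k (σ k)) (fun N => ⋃ i ≥ N, O i) (fun k => hB0 k (σ k)) fun k => hBO k (σ k)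
    refine ⟨ν, hν, ?_, _, (σ 0).2.2.1, hνball⟩
    rw [Set.compl_iInter]
    exact measure_iUnion_null hν0
  rw [← top_le_iff]
  refine ENNReal.le_of_forall_pos_nnreal_lt fun c hc _ => ?_
  set Λ := ⋂ N : ℕ, ⋃ i ≥ N, O i with hΛ
  -- A set of diameter `d > 0` lies in a ball of radius `2 * d`, of mass at most `ε * (4 * d) ^ s =
  -- d ^ s / c`.
  set ε : ℝ := (c * 4 ^ s)⁻¹ with hε
  have hc' : (0 : ℝ) < c := by exact_mod_cast hc
  have hε0 : 0 < ε := by positivity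
  obtain ⟨ν, hν, hνΛ, e₀, he₀, hball⟩ := main ε hε0
  have hle : (c : ℝ≥0∞) • ν ≤ Measure.hausdorffMeasure s := by
    refine Measure.le_hausdorffMeasure s _ (ENNReal.ofReal (e₀ / 2))
      (ENNReal.ofReal_pos.2 (half_pos he₀)) fun E hE => ?_
    have hset : ∀ t : ℝ, Metric.ediam E < ENNReal.ofReal t → 0 < t → t ≤ e₀ →
        ((c : ℝ≥0∞) • ν) E ≤ ENNReal.ofReal ((t / 2) ^ s) := by
      intro t hEt ht hte
      rcases E.eq_empty_or_nonempty with rfl | ⟨x, hx⟩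
      · simp
      · have hsub : E ⊆ Metric.ball x t := fun y hy => by
          have := (Metric.edist_le_ediam_of_mem hy hx).trans_lt hEt
          rwa [edist_dist, ENNReal.ofReal_lt_ofReal_iff ht] at this
        rw [Measure.smul_apply, smul_eq_mul]
        refine (mul_le_mul' le_rfl ((measure_mono hsub).trans (hball x t ht hte))).trans ?_
        rw [← ENNReal.ofReal_coe_nnreal, ← ENNReal.ofReal_mul hc'.le]
        refine ENNReal.ofReal_le_ofReal (le_of_eq ?_)
        rw [hε, show 2 * t = 4 * (t / 2) by ring, Real.mul_rpow (by norm_num) (half_pos ht).le]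
        field_simp
    have htop : Metric.ediam E ≠ ∞ := ne_top_of_le_ne_top ENNReal.ofReal_ne_top hE
    set d := (Metric.ediam E).toReal with hd
    have hdE : Metric.ediam E = ENNReal.ofReal d := (ENNReal.ofReal_toReal htop).symm
    have hd0 : 0 ≤ d := ENNReal.toReal_nonneg
    have hde : d ≤ e₀ / 2 := ENNReal.toReal_le_of_le_ofReal (half_pos he₀).le hE
    -- For diameter zero, let the radius of the enclosing ball tend to `0`; since `0 < s` the bound
    -- vanishes.
    rcases hd0.eq_or_lt with h0 | hpos
    · have hlim : Tendsto (fun t : ℝ => ENNReal.ofReal ((t / 2) ^ s)) (𝓝[>] 0) (𝓝 0) := by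
        have h1 : Tendsto (fun t : ℝ => (t / 2) ^ s) (𝓝 0) (𝓝 ((0 / 2) ^ s)) :=
          (((continuous_id.div_const 2).continuousAt).rpow_const (Or.inr hs.le)).tendsto
        rw [zero_div, Real.zero_rpow hs.ne'] at h1
        have := (ENNReal.continuous_ofReal.tendsto 0).comp
          (h1.mono_left (nhdsWithin_le_nhds (s := Set.Ioi 0)))
        rwa [ENNReal.ofReal_zero] at this
      refine le_trans (ge_of_tendsto hlim ?_) zero_le
      filter_upwards [Ioc_mem_nhdsGT he₀] with t ht
      refine hset t ?_ ht.1 ht.2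
      rw [hdE, ← h0]
      exact (ENNReal.ofReal_lt_ofReal_iff ht.1).2 ht.1
    · refine (hset (2 * d) ?_ (by positivity) (by linarith)).trans (le_of_eq ?_)
      · rw [hdE]
        exact (ENNReal.ofReal_lt_ofReal_iff (by positivity)).2 (by linarith)
      · rw [hdE, ENNReal.ofReal_rpow_of_pos hpos, mul_div_cancel_left₀ _ (by norm_num)]
  have hΛm : MeasurableSet Λ := MeasurableSet.iInter fun N => (hOo N).measurableSet
  calc (c : ℝ≥0∞) = ((c : ℝ≥0∞) • ν) Λ := by
        rw [Measure.smul_apply, smul_eq_mul, (prob_compl_eq_zero_iff hΛm).1 hνΛ, mul_one]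
    _ ≤ _ := hle Λ

/-! ### Choice of levels and radii. -/

/-- The bound says `x ^ (s - γ) ≤ y ^ (δ - γ)`, which is at most `y ^ (s - γ)` because `y ≤ 1`. It
supplies `q ≤ ρ`, without which the level measure is not available. -/
theorem le_of_rpow_mul_rpow_le_one {x y γ s δ : ℝ} (hx : 0 < x) (hy : 0 < y) (hy1 : y ≤ 1)
    (hγs : γ < s) (hsδ : s < δ) (h : x ^ (s - γ) * y ^ (γ - δ) ≤ 1) : x ≤ y := by
  have h1 : x ^ (s - γ) ≤ y ^ (δ - γ) := by
    have : y ^ (γ - δ) = (y ^ (δ - γ))⁻¹ := by rw [← Real.rpow_neg hy.le]; congr 1; ring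
    rwa [this, ← div_eq_mul_inv, div_le_one (by positivity)] at h
  have h2 : y ^ (δ - γ) ≤ y ^ (s - γ) :=
    Real.rpow_le_rpow_of_exponent_ge hy hy1 (by linarith)
  exact (Real.rpow_le_rpow_iff hx.le hy.le (sub_pos.2 hγs)).1 (h1.trans h2)

theorem exists_strictMono_of_not_summable_indicator {g : ℕ → ℝ} {S : Set ℕ}
    (h : ¬ Summable (S.indicator g)) :
    ∃ φ : ℕ → ℕ, StrictMono φ ∧ (∀ i, φ i ∈ S) ∧ ¬ Summable (g ∘ φ) := by
  classical
  have hinf : S.Infinite := fun hfin => h <| summable_of_hasFiniteSupport <|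
    hfin.subset Set.support_indicator_subset
  have := hinf.to_subtype
  refine ⟨fun i => (Nat.Subtype.orderIsoOfNat S i : ℕ), ?_, fun i => Subtype.prop _, fun hs => h ?_⟩
  · exact (Subtype.strictMono_coe _).comp (Nat.Subtype.orderIsoOfNat S).strictMono
  · rw [← summable_subtype_iff_indicator]
    exact ((Nat.Subtype.orderIsoOfNat S).toEquiv.summable_iff (f := g ∘ ((↑) : S → ℕ))).1 hs

/-- If `ρ` decays geometrically, the divergence of the sum is caused by the indices at which `ψ`
drops by a definite factor. -/
theorem exists_geometric_subsequence {ψ ρ : ℕ → ℝ} (hψ : ∀ n, 0 < ψ n) (hρ : ∀ n, 0 < ρ n)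
    (hψa : Antitone ψ) {γ s δ lam : ℝ} (hγs : γ < s) (hsδ : s < δ) (hl0 : 0 < lam) (hl1 : lam < 1)
    (hstep : ∀ n, ρ (n + 1) ≤ lam * ρ n) (hle : ∀ n, ψ n ^ (s - γ) * ρ n ^ (γ - δ) ≤ 1)
    (hsum : ¬ Summable fun n => ψ n ^ (s - γ) * ρ n ^ (γ - δ)) :
    ∃ θ : ℝ, 0 < θ ∧ θ < 1 ∧ ∃ φ : ℕ → ℕ, StrictMono φ ∧
      (∀ i, ψ (φ (i + 1)) ≤ θ * ψ (φ i)) ∧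
      ¬ Summable fun i => ψ (φ i) ^ (s - γ) * ρ (φ i) ^ (γ - δ) := by
  have hsγ : 0 < s - γ := sub_pos.2 hγs
  set g : ℕ → ℝ := fun n => ψ n ^ (s - γ) * ρ n ^ (γ - δ) with hg
  have hg0 : ∀ n, 0 < g n := fun n =>
    mul_pos (Real.rpow_pos_of_pos (hψ n) _) (Real.rpow_pos_of_pos (hρ n) _)
  -- Chosen so that `θ ^ (s - γ)` undoes only half the exponent in the growth `lam ^ (γ - δ)` coming
  -- from `ρ`; the net factor `L` still exceeds `1`.
  set θ : ℝ := lam ^ ((δ - γ) / 2 / (s - γ)) with hθ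
  have hθ0 : 0 < θ := Real.rpow_pos_of_pos hl0 _
  have hθ1 : θ < 1 := Real.rpow_lt_one hl0.le hl1 (div_pos (by linarith) hsγ)
  set L : ℝ := lam ^ ((γ - δ) / 2) with hL
  have hL1 : 1 < L := Real.one_lt_rpow_of_pos_of_lt_one_of_neg hl0 hl1 (by linarith)
  have hθL : θ ^ (s - γ) * lam ^ (γ - δ) = L := by
    rw [hθ, ← Real.rpow_mul hl0.le, ← Real.rpow_add hl0, div_mul_cancel₀ _ hsγ.ne', hL]
    congr 1
    ring
  set S : Set ℕ := {n | ψ (n + 1) ≤ θ * ψ n} with hS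
  have hgrow : ∀ n, n ∉ S → L * g n ≤ g (n + 1) := by
    intro n hn
    have h1 : θ * ψ n ≤ ψ (n + 1) := (not_le.1 hn).le
    have h2 : (lam * ρ n) ^ (γ - δ) ≤ ρ (n + 1) ^ (γ - δ) :=
      Real.rpow_le_rpow_of_nonpos (hρ _) (hstep n) (by linarith)
    have h3 : (θ * ψ n) ^ (s - γ) ≤ ψ (n + 1) ^ (s - γ) :=
      Real.rpow_le_rpow (mul_pos hθ0 (hψ n)).le h1 hsγ.le
    calc L * g n = (θ * ψ n) ^ (s - γ) * (lam * ρ n) ^ (γ - δ) := by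
          rw [Real.mul_rpow hθ0.le (hψ n).le, Real.mul_rpow hl0.le (hρ n).le, ← hθL, hg]
          ring
      _ ≤ g (n + 1) := mul_le_mul h3 h2 (Real.rpow_nonneg (mul_pos hl0 (hρ n)).le _)
          (Real.rpow_nonneg (hψ _).le _)
  -- Off `S` the terms grow by at least `L`, so such a run is controlled by the term after it, which
  -- is either in `S` or the boundary term `g N ≤ 1`.
  have hpartial : ∀ N, (L - 1) * ∑ n ∈ Finset.range N, g n ≤
      L * (∑ n ∈ Finset.range N, S.indicator g n) + g N := by
    intro N
    induction N with
    | zero => simpa using (hg0 0).le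
    | succ N ih =>
      rw [Finset.sum_range_succ, Finset.sum_range_succ]
      by_cases hN : N ∈ S
      · rw [Set.indicator_of_mem hN]
        linarith [(hg0 (N + 1)).le]
      · rw [Set.indicator_of_notMem hN]
        linarith [hgrow N hN]
  have hind : ¬ Summable (S.indicator g) := by
    intro h
    refine hsum (summable_of_sum_range_le (c := (L * (∑' n, S.indicator g n) + 1) / (L - 1))
      (fun n => (hg0 n).le) fun N => ?_)
    rw [le_div_iff₀ (by linarith), mul_comm]
    refine (hpartial N).trans (add_le_add (mul_le_mul_of_nonneg_left ?_ (by linarith)) (hle N))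
    exact h.sum_le_tsum _ fun n _ => Set.indicator_nonneg (fun n _ => (hg0 n).le) n
  obtain ⟨φ, hφ, hφS, hφsum⟩ := exists_strictMono_of_not_summable_indicator hind
  refine ⟨θ, hθ0, hθ1, φ, hφ, fun i => ?_, hφsum⟩
  exact (hψa (Nat.succ_le_of_lt (hφ (Nat.lt_succ_self i)))).trans (hφS i)

/-- When `g` is frequently bounded below, the neighbourhoods can be shrunk along a subsequence so
that `g` becomes constant. -/
theorem exists_geometric_subsequence_of_frequently {ψ ρ : ℕ → ℝ} (hψ : ∀ n, 0 < ψ n)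
    (hρ : ∀ n, 0 < ρ n) (hρ0 : Tendsto ρ atTop (𝓝 0)) {γ s δ c : ℝ} (hγs : γ < s) (hsδ : s < δ)
    (hc0 : 0 < c) (hc1 : c ≤ 1) (hfreq : ∃ᶠ n in atTop, c < ψ n ^ (s - γ) * ρ n ^ (γ - δ)) :
    ∃ (φ : ℕ → ℕ) (q : ℕ → ℝ), StrictMono φ ∧ (∀ i, 0 < q i) ∧ (∀ i, q i < ψ (φ i)) ∧
      (∀ i, q i ≤ ρ (φ i)) ∧ (∀ i, q (i + 1) ≤ 1 / 2 * q i) ∧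
      ¬ Summable fun i => q i ^ (s - γ) * ρ (φ i) ^ (γ - δ) := by
  have hsγ : 0 < s - γ := sub_pos.2 hγs
  -- Solving for the radius at which `g` equals a fixed multiple of `c`: the new series has constant
  -- positive terms, and since `p` tends to `0` it can be thinned to decay geometrically.
  set p : ℕ → ℝ := fun n => 1 / 2 * (c * ρ n ^ (δ - γ)) ^ (s - γ)⁻¹ with hp
  have hcρ : ∀ n, 0 < c * ρ n ^ (δ - γ) := fun n => mul_pos hc0 (Real.rpow_pos_of_pos (hρ n) _)
  have hp0 : ∀ n, 0 < p n := fun n => mul_pos (by norm_num) (Real.rpow_pos_of_pos (hcρ n) _)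
  have hpval : ∀ n, p n ^ (s - γ) * ρ n ^ (γ - δ) = (1 / 2) ^ (s - γ) * c := by
    intro n
    have h1 : ρ n ^ (δ - γ) * ρ n ^ (γ - δ) = 1 := by
      rw [← Real.rpow_add (hρ n), show δ - γ + (γ - δ) = 0 by ring, Real.rpow_zero]
    rw [hp, Real.mul_rpow (by norm_num) (Real.rpow_nonneg (hcρ n).le _), ← Real.rpow_mul (hcρ n).le,
      inv_mul_cancel₀ hsγ.ne', Real.rpow_one]
    linear_combination (1 / 2) ^ (s - γ) * c * h1
  have hhalf : ((1 : ℝ) / 2) ^ (s - γ) < 1 :=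
    Real.rpow_lt_one (by norm_num) (by norm_num) hsγ
  have hptend : Tendsto p atTop (𝓝 0) := by
    have h1 : Tendsto (fun n => ρ n ^ (δ - γ)) atTop (𝓝 (0 ^ (δ - γ))) :=
      hρ0.rpow_const (Or.inr (by linarith))
    rw [Real.zero_rpow (by linarith)] at h1
    have h2 := ((h1.const_mul c).rpow_const (p := (s - γ)⁻¹)
      (Or.inr (inv_nonneg.2 hsγ.le))).const_mul (1 / 2 : ℝ)
    rwa [mul_zero, Real.zero_rpow (inv_pos.2 hsγ).ne', mul_zero] at h2
  set S : Set ℕ := {n | c < ψ n ^ (s - γ) * ρ n ^ (γ - δ) ∧ ρ n ≤ 1} with hS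
  have hSfreq : ∃ᶠ n in atTop, n ∈ S :=
    hfreq.and_eventually (hρ0.eventually (ge_mem_nhds one_pos))
  have hnext : ∀ n : S, ∃ n' : S, (n : ℕ) < n' ∧ p n' ≤ 1 / 2 * p n := by
    intro n
    obtain ⟨k, ⟨hkS, hk⟩, hkn⟩ := ((hSfreq.and_eventually (hptend.eventually
      (ge_mem_nhds (show 0 < 1 / 2 * p n from mul_pos (by norm_num) (hp0 n))))).and_eventually
      (eventually_gt_atTop (n : ℕ))).exists
    exact ⟨⟨k, hkS⟩, hkn, hk⟩
  choose next hlt hnexthalf using hnext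
  obtain ⟨n₀, hn₀⟩ := hSfreq.exists
  let σ : ℕ → S := fun i => Nat.rec ⟨n₀, hn₀⟩ (fun _ n => next n) i
  refine ⟨fun i => (σ i).1, fun i => p (σ i).1, strictMono_nat_of_lt_succ fun i => hlt (σ i),
    fun i => hp0 _, fun i => ?_, fun i => ?_, fun i => hnexthalf (σ i), ?_⟩
  · have h1 := (σ i).2.1
    have h2 : p (σ i).1 ^ (s - γ) * ρ (σ i).1 ^ (γ - δ) < c := by
      rw [hpval]
      exact mul_lt_of_lt_one_left hc0 hhalf
    exact (Real.rpow_lt_rpow_iff (hp0 _).le (hψ _).le hsγ).1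
      (lt_of_mul_lt_mul_right (h2.trans h1) (Real.rpow_nonneg (hρ _).le _))
  · refine le_of_rpow_mul_rpow_le_one (hp0 _) (hρ _) (σ i).2.2 hγs hsδ ?_
    rw [hpval]
    exact mul_le_one₀ hhalf.le hc0.le hc1
  · simp only [hpval]
    rw [summable_const_iff]
    positivity

/-! ### Assembly for the limsup set. -/

/-- The Hausdorff measure of the limsup set is infinite as soon as the sum diverges along a
subsequence at which the radii of the neighbourhoods decay geometrically. -/
theorem hausdorffMeasure_limsupSet_eq_top {Ω J : Type*} [MetricSpace Ω] [CompactSpace Ω]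
    [MeasurableSpace Ω] [BorelSpace Ω] (m : Measure Ω) [IsProbabilityMeasure m]
    (R : J → Set Ω) (β : J → ℝ) (hβ : IsWeight β) (l u : ℕ → ℝ) (hlu : IsLowerUpper l u)
    (ρ : ℝ → ℝ) (hρ : IsUbiquityFunction ρ) (ψ : ℝ → ℝ) (hψ : IsApproximating ψ)
    (δ γ s : ℝ) (hm : MeasureM2 m δ) (hub : IsLocallyUbiquitous m R β ρ l u γ)
    (hγs : γ < s) (hsδ : s < δ) {n : ℕ → ℕ} (hn : StrictMono n) {q : ℕ → ℝ} (hq : ∀ i, 0 < q i)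
    (hqψ : ∀ i, q i < ψ (u (n i))) (hqρ : ∀ i, q i ≤ ρ (u (n i))) {θ : ℝ} (hθ0 : 0 < θ)
    (hθ1 : θ < 1) (hstep : ∀ i, q (i + 1) ≤ θ * q i)
    (hsum : ¬ Summable fun i => q i ^ (s - γ) * ρ (u (n i)) ^ (γ - δ)) :
    Measure.hausdorffMeasure s (limsupSet R β ψ) = ∞ := by
  obtain ⟨hδ, a, b, r₀, ha, hb, hr₀, hball⟩ := hm
  obtain ⟨⟨κ, r₁, hκ, hr₁, hubiq⟩, hγ, -, c₁, c₂, hc₁, hc₂, hint⟩ := hub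
  have hu0 : ∀ k, 0 < u k := fun k => (hlu.lower_pos k).trans (hlu.lt k)
  have hutop : Tendsto u atTop atTop := tendsto_atTop_mono (fun k => (hlu.lt k).le) hlu.tendsto
  have hρu : Tendsto (fun i => ρ (u (n i))) atTop (𝓝 0) :=
    hρ.2.comp (hutop.comp hn.tendsto_atTop)
  -- Discarding `i₀` levels makes `4 * ρ ≤ r₀` and the intersection conditions hold at every
  -- remaining level.
  obtain ⟨i₀, hi₀⟩ := eventually_atTop.1 ((hρu.eventually
    (ge_mem_nhds (show 0 < r₀ / 4 by positivity))).and (hn.tendsto_atTop.eventually hint))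
  set I : ℕ → Set J := fun k => {α | l k < β α ∧ β α ≤ u k} with hI
  set N : ℕ → ℕ := fun i => n (i + i₀) with hN
  have hNtop : Tendsto N atTop atTop := hn.tendsto_atTop.comp (tendsto_add_atTop_nat i₀)
  set Q : ℕ → ℝ := fun i => q (i + i₀) with hQ
  set P : ℕ → ℝ := fun i => ρ (u (N i)) with hP
  have hP0 : ∀ i, 0 < P i := fun i => hρ.1 _ (hu0 _)
  have hlevel := fun i => exists_level_measure (s := s) m R (I (N i)) ha hb hc₁ hc₂ hball
    (hq (i + i₀)) (hqρ (i + i₀)) (by linarith [(hi₀ (i + i₀) (by omega)).1])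
    (fun α hα => (hi₀ (i + i₀) (by omega)).2 α hα.2)
  choose ν A hAc hAQ hA0 hνm hsmall hlarge hlow using hlevel
  set O : ℕ → Set Ω := fun i => ⋃ α ∈ I (N i), Metric.thickening (ψ (u (N i))) (R α) with hO
  have hOo : ∀ i, IsOpen (O i) := fun i => isOpen_biUnion fun α _ => Metric.isOpen_thickening
  -- The strict inequality `q < ψ` puts closed `q`-neighbourhoods inside open `ψ`-neighbourhoods.
  have hAO : ∀ i, A i ⊆ O i := fun i => (hAQ i).trans <| Set.iUnion₂_mono fun α _ =>
    Metric.cthickening_subset_thickening' (hψ.1 _ (hu0 _)) (hqψ (i + i₀)) _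
  have hmpos : ∀ x r, 0 < r → m (Metric.ball x r) ≠ 0 := by
    intro x r hr
    have h1 := (hball x (min r r₀) (lt_min hr hr₀) (min_le_right _ _)).1
    have h2 := measure_mono (μ := m) (Metric.ball_subset_ball (x := x) (min_le_left r r₀))
    have : 0 < min r r₀ := lt_min hr hr₀
    exact ((ENNReal.ofReal_pos.2 (by positivity)).trans_le (h1.trans h2)).ne'
  have hpow : ∀ r : ℝ, 0 < r → b * (2 * r) ^ δ = b * 4 ^ δ / a * (a * (r / 2) ^ δ) := by
    intro r hr
    rw [show 2 * r = 4 * (r / 2) by ring, Real.mul_rpow (by norm_num) (half_pos hr).le]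
    field_simp
  -- Ubiquity is applied to the ball of radius `r / 2`, whose resonant part `ν i` charges inside
  -- radius `r`; the outer factor `b * 4 ^ δ / a` compares radii `2 * r` and `r / 2`.
  have hcharge : ∀ x r, 0 < r → r ≤ min (r₀ / 3) r₁ → ∀ᶠ i in atTop,
      m (Metric.ball x (2 * r)) ≤ ENNReal.ofReal (b * 4 ^ δ / a * (κ⁻¹ * (b * 4 ^ δ / a))) *
        ν i (Metric.ball x r) := by
    intro x r hr hrle
    have hr0 := hrle.trans (min_le_left _ _)
    have hr1 := hrle.trans (min_le_right _ _)
    have hPtend : Tendsto P atTop (𝓝 0) := hρu.comp (tendsto_add_atTop_nat i₀)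
    filter_upwards [hNtop.eventually (hubiq x (r / 2) (half_pos hr) (by linarith)),
      hPtend.eventually (ge_mem_nhds (show 0 < r / 9 by positivity))] with i h1 h2
    have h3 := hlow i x r (by linarith)
    have h4 : m (Metric.ball x (r / 2)) ≤
        ENNReal.ofReal (κ⁻¹ * (b * 4 ^ δ / a)) * ν i (Metric.ball x r) := by
      calc m (Metric.ball x (r / 2))
          = ENNReal.ofReal κ⁻¹ * (ENNReal.ofReal κ * m (Metric.ball x (r / 2))) := by
            rw [← mul_assoc, ← ENNReal.ofReal_mul (by positivity), inv_mul_cancel₀ hκ.ne',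
              ENNReal.ofReal_one, one_mul]
        _ ≤ ENNReal.ofReal κ⁻¹ * (ENNReal.ofReal (b * 4 ^ δ / a) * ν i (Metric.ball x r)) :=
            mul_le_mul' le_rfl (h1.trans h3)
        _ = _ := by rw [ENNReal.ofReal_mul (by positivity), mul_assoc]
    calc m (Metric.ball x (2 * r)) ≤ ENNReal.ofReal (b * (2 * r) ^ δ) :=
          (hball x (2 * r) (by positivity) (by linarith)).2
      _ = ENNReal.ofReal (b * 4 ^ δ / a) * ENNReal.ofReal (a * (r / 2) ^ δ) := by
          rw [hpow r hr, ENNReal.ofReal_mul (by positivity)]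
      _ ≤ ENNReal.ofReal (b * 4 ^ δ / a) *
          (ENNReal.ofReal (κ⁻¹ * (b * 4 ^ δ / a)) * ν i (Metric.ball x r)) := by
          gcongr
          exact (hball x (r / 2) (half_pos hr) (by linarith)).1.trans h4
      _ = _ := by rw [ENNReal.ofReal_mul (p := b * 4 ^ δ / a) (by positivity), mul_assoc]
  have htop : Measure.hausdorffMeasure s (⋂ k : ℕ, ⋃ i ≥ k, O i) = ∞ := by
    refine hausdorffMeasure_eq_top_of_refining (m := m) hOo (hγ.trans_lt hγs) fun ε hε μ hμ =>
      exists_refining_measure (q := Q) (ρ := P) (g := fun i => Q i ^ (s - γ) * P i ^ (γ - δ))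
        (K₁ := b / (c₁ * a) * b * (1 + c₂ * 3 ^ γ)) (K₂ := b * 3 ^ δ) (t₀ := min (r₀ / 3) r₁)
        (e := min (δ - s) (s - γ)) (δ := δ)
        (fun i => hq _) hθ0 hθ1 (fun i => ?_) (lt_min (by linarith) (by linarith))
        (fun i => mul_pos (Real.rpow_pos_of_pos (hq _) _) (Real.rpow_pos_of_pos (hP0 i) _))
        ?_ (by positivity) (by positivity) hAc hAO hA0 hνm hsmall ?_
        (lt_min (by positivity) hr₁) hsδ hmpos hcharge hε hμ
    · have := hstep (i + i₀)
      rwa [show i + i₀ + 1 = i + 1 + i₀ by ring] at this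
    · exact fun h => hsum ((summable_nat_add_iff (f := fun i => q i ^ (s - γ) *
        ρ (u (n i)) ^ (γ - δ)) i₀).1 h)
    · intro i x t ht htt
      refine (hlarge i x t ht (by linarith [htt.trans (min_le_left _ _)])).trans
        (ENNReal.ofReal_le_ofReal (le_of_eq ?_))
      rw [Real.mul_rpow (by norm_num) ((hP0 i).le.trans ht), mul_assoc]
  rw [← top_le_iff, ← htop]
  refine measure_mono fun x hx => ?_
  -- Finitely many indices would have bounded weights, but `x` lies in some `O i` whose indices have
  -- weight beyond that bound; `ψ (u (N i)) ≤ ψ (β α)` by monotonicity.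
  intro hfin
  obtain ⟨K, hK⟩ := (hfin.image β).bddAbove
  obtain ⟨k, hk⟩ := eventually_atTop.1
    (hNtop.eventually (hlu.tendsto.eventually (eventually_ge_atTop K)))
  obtain ⟨i, hi, hxi⟩ := Set.mem_iUnion₂.1 (Set.mem_iInter.1 hx k)
  obtain ⟨α, hα, hxα⟩ := Set.mem_iUnion₂.1 hxi
  have h1 : β α ≤ K := hK (Set.mem_image_of_mem β
    (Metric.thickening_mono (hψ.2 (hβ.1 α) (hu0 _) hα.2) _ hxα))
  linarith [hk i hi, hα.1]

end Ubiquity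

/-! ### The two cases. -/

theorem corollary4 {Ω J : Type*} [MetricSpace Ω] [CompactSpace Ω] [MeasurableSpace Ω]
    [BorelSpace Ω] (m : Measure Ω) [IsProbabilityMeasure m]
    (R : J → Set Ω) (β : J → ℝ) (hβ : Ubiquity.IsWeight β)
    (l u : ℕ → ℝ) (hlu : Ubiquity.IsLowerUpper l u)
    (ρ : ℝ → ℝ) (hρ : Ubiquity.IsUbiquityFunction ρ)
    (ψ : ℝ → ℝ) (hψ : Ubiquity.IsApproximating ψ)
    (δ γ s : ℝ) (hm : Ubiquity.MeasureM2 m δ)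
    (hub : Ubiquity.IsLocallyUbiquitous m R β ρ l u γ)
    (hγs : γ < s) (hsδ : s < δ) :
    (Ubiquity.limsupG ψ ρ u s γ δ = 0 →
      Ubiquity.IsRegular ψ u ∨ Ubiquity.IsRegular ρ u →
      ∑' n, ENNReal.ofReal (Ubiquity.gFun ψ ρ s γ δ (u n)) = ∞ →
      Measure.hausdorffMeasure s (Ubiquity.limsupSet R β ψ) = ∞) ∧
    (0 < Ubiquity.limsupG ψ ρ u s γ δ →
      Measure.hausdorffMeasure s (Ubiquity.limsupSet R β ψ) = ∞) := by
  have hu0 : ∀ k, 0 < u k := fun k => (hlu.lower_pos k).trans (hlu.lt k)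
  have hutop : Tendsto u atTop atTop := tendsto_atTop_mono (fun k => (hlu.lt k).le) hlu.tendsto
  have hρu : Tendsto (fun n => ρ (u n)) atTop (𝓝 0) := hρ.2.comp hutop
  have hψ0 : ∀ n, 0 < ψ (u n) := fun n => hψ.1 _ (hu0 n)
  have hρ0 : ∀ n, 0 < ρ (u n) := fun n => hρ.1 _ (hu0 n)
  refine ⟨fun hG hreg hdiv => ?_, fun hG => ?_⟩
  · have hle1 : ∀ᶠ n in atTop, Ubiquity.gFun ψ ρ s γ δ (u n) ≤ 1 := by
      have h := eventually_lt_of_limsup_lt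
        (show Ubiquity.limsupG ψ ρ u s γ δ < 1 by rw [hG]; exact one_pos)
      filter_upwards [h] with n hn
      exact (ENNReal.ofReal_lt_one.1 hn).le
    have hsum : ¬ Summable fun n => Ubiquity.gFun ψ ρ s γ δ (u n) := fun h =>
      h.tsum_ofReal_ne_top hdiv
    have key : ∃ θ : ℝ, 0 < θ ∧ θ < 1 ∧ ∃ φ : ℕ → ℕ, StrictMono φ ∧
        (∀ i, ψ (u (φ (i + 1))) ≤ θ * ψ (u (φ i))) ∧
        (∀ i, ψ (u (φ i)) ≤ ρ (u (φ i))) ∧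
        ¬ Summable fun i => Ubiquity.gFun ψ ρ s γ δ (u (φ i)) := by
      have hρ1 := hρu.eventually (ge_mem_nhds one_pos)
      rcases hreg with ⟨lam, hl0, hl1, hlam⟩ | ⟨lam, hl0, hl1, hlam⟩
      · obtain ⟨N, hN⟩ := eventually_atTop.1 ((hle1.and hρ1).and hlam)
        refine ⟨lam, hl0, hl1, fun i => i + N, fun i j hij => by simpa using hij, fun i => ?_,
          fun i => ?_, ?_⟩
        · have := (hN (i + N) (by omega)).2
          rwa [show i + N + 1 = i + 1 + N by ring] at this
        · exact Ubiquity.le_of_rpow_mul_rpow_le_one (hψ0 _) (hρ0 _) (hN (i + N) (by omega)).1.2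
            hγs hsδ (hN (i + N) (by omega)).1.1
        · exact fun h => hsum ((summable_nat_add_iff
            (f := fun n => Ubiquity.gFun ψ ρ s γ δ (u n)) N).1 h)
      · obtain ⟨N, hN⟩ := eventually_atTop.1 ((hle1.and hρ1).and hlam)
        obtain ⟨θ, hθ0, hθ1, φ, hφ, hφψ, hφsum⟩ := Ubiquity.exists_geometric_subsequence
          (ψ := fun n => ψ (u (n + N))) (ρ := fun n => ρ (u (n + N))) (fun n => hψ0 _)
          (fun n => hρ0 _) (fun i j hij => hψ.2 (hu0 _) (hu0 _) (hlu.upper_mono (by omega)))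
          hγs hsδ hl0 hl1
          (fun n => by
            have := (hN (n + N) (by omega)).2
            rwa [show n + N + 1 = n + 1 + N by ring] at this)
          (fun n => (hN (n + N) (by omega)).1.1)
          (fun h => hsum ((summable_nat_add_iff
            (f := fun n => Ubiquity.gFun ψ ρ s γ δ (u n)) N).1 h))
        refine ⟨θ, hθ0, hθ1, fun i => φ i + N, fun i j hij => by simpa using hφ hij, hφψ,
          fun i => ?_, hφsum⟩
        exact Ubiquity.le_of_rpow_mul_rpow_le_one (hψ0 _) (hρ0 _) (hN (φ i + N) (by omega)).1.2
          hγs hsδ (hN (φ i + N) (by omega)).1.1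
    obtain ⟨θ, hθ0, hθ1, φ, hφ, hφψ, hψρ, hφsum⟩ := key
    -- Halving `ψ` gives the strict inequality `q < ψ` and changes the series only by a constant
    -- factor.
    refine Ubiquity.hausdorffMeasure_limsupSet_eq_top m R β hβ l u hlu ρ hρ ψ hψ δ γ s hm hub hγs
      hsδ hφ (q := fun i => 1 / 2 * ψ (u (φ i))) (fun i => mul_pos (by norm_num) (hψ0 _))
      (fun i => by linarith [hψ0 (φ i)]) (fun i => by linarith [hψ0 (φ i), hψρ i]) hθ0 hθ1
      (fun i => by linarith [hφψ i]) fun h => hφsum ?_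
    refine (summable_mul_left_iff (a := ((1 : ℝ) / 2) ^ (s - γ)) (by positivity)).1 (h.congr ?_)
    intro i
    rw [Real.mul_rpow (by norm_num) (hψ0 _).le, Ubiquity.gFun, mul_assoc]
  -- Taking `c` below `1` as well as below `G` is what later yields `q ≤ ρ`.
  · obtain ⟨c, hc0, hc⟩ := ENNReal.lt_iff_exists_nnreal_btwn.1 (lt_min hG one_pos)
    have hfreq : ∃ᶠ n in atTop, (c : ℝ) < ψ (u n) ^ (s - γ) * ρ (u n) ^ (γ - δ) := by
      refine (frequently_lt_of_lt_limsup (by isBoundedDefault)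
        (hc.trans_le (min_le_left _ _))).mono fun n hn => ?_
      rw [← ENNReal.ofReal_coe_nnreal, ENNReal.ofReal_lt_ofReal_iff'] at hn
      exact hn.1
    obtain ⟨φ, q, hφ, hq, hqψ, hqρ, hstep, hsum⟩ :=
      Ubiquity.exists_geometric_subsequence_of_frequently hψ0 hρ0 hρu hγs hsδ
        (by exact_mod_cast hc0) (by exact_mod_cast (hc.trans_le (min_le_right _ _)).le) hfreq
    exact Ubiquity.hausdorffMeasure_limsupSet_eq_top m R β hβ l u hlu ρ hρ ψ hψ δ γ s hm hub hγs
      hsδ hφ hq hqψ hqρ (by norm_num) (by norm_num) hstep hsum
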